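/- Let $X$ be a smooth, projective, split toric variety over $\mathbf Q$ of dimension $n\ge 1$, given by a smooth, complete, projective fan $\Sigma$ in $N=\mathbf Z^n$ with set of rays $\Sigma(1)$ and primitive generators $n_\rho$ ($\rho\in\Sigma(1)$). Let $M=\operatorname{Hom}(N,\mathbf Z)$, let $\operatorname{Pic}(X)=\mathbf Z^{\Sigma(1)}/M$, where $m\in M$ is sent to $(\langle m,n_\rho\rangle)_\rho$, let $t$ be its rank, let $[D_\rho]$ be the class of the invariant divisor of $\rho$, and let $\omega_X^{-1}=\sum_\rho[D_\rho]$. Put $\operatorname{Pic}(X)^\vee_{\mathbf R}=\operatorname{Hom}(\operatorname{Pic}(X),\mathbf R)$. Let $\mathcal T(\mathbf R)\subset\mathbf R^{\Sigma(1)}$ be the set of $y$ such that $\{\rho : y_\rho=0\}$ is contained in the set of rays of a cone of $\Sigma$ (the real points of the universal torsor), let $T_{\Sigma(1)}(\mathbf R)=(\mathbf R^\times)^{\Sigma(1)}\subset\mathcal T(\mathbf R)$, and let $X(\mathbf R)=\mathcal T(\mathbf R)/\operatorname{Hom}(\operatorname{Pic}(X),\mathbf R^\times)$, where $s$ acts on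 the coordinate $y_\rho$ by multiplication by $s([D_\rho])$. For a maximal cone $\sigma$ let $U_\sigma(\mathbf R)\cong\mathbf R^{\sigma(1)}$ be the corresponding affine chart of $X(\mathbf R)$, with the coordinates given by the basis of $M$ dual to $(n_\rho)_{\rho\in\sigma(1)}$, and let $C_\sigma\subset U_\sigma(\mathbf R)$ be the set of points with $|\chi^m|\le 1$ for all $m\in\sigma^\vee\cap M$. The torsor height $h_{\mathcal T,\infty}:\mathcal T(\mathbf R)\to\operatorname{Pic}(X)^\vee_{\mathbf R}$ is defined by $$h_{\mathcal T,\infty}(y)([D])=\log\Big|\prod_{\rho}y_\rho^{D(\sigma)_\rho}\Big|$$ for any maximal cone $\sigma$ such that $y$ lies over $C_\sigma$, where $D(\sigma)$ is the unique element of $D+M\subset\mathbf Z^{\Sigma(1)}$ (i.e. the unique invariant divisor linearly equivalent to $D$) with $D(\sigma)_\rho=0$ for all $\rho\in\sigma(1)$; this does not depend on the choice of $\sigma$. Let $\mu_{X,\infty}$ be the measure on $X(\mathbf R)$ whose restriction to each $U_\sigma(\mathbf R)$ is $\|\partial_{x_1}\wedge\dots\wedge\partial_{x_n}\|\,dx_1\cdots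 dx_n$, where $\|\partial_{x_1}\wedge\dots\wedge\partial_{x_n}\|(x)=\exp\big(-h_{\mathcal T,\infty}(\tilde x)(\omega_X^{-1})\big)$ and $\tilde x\in\mathcal T(\mathbf R)$ has the coordinates of $x$ on $\sigma(1)$ and coordinates $1$ outside $\sigma(1)$. Let $\nu$ be the measure $e^{\langle\omega_X^{-1},y\rangle}dy$ on $\operatorname{Pic}(X)^\vee_{\mathbf R}$, where $dy$ is the Haar measure for which the lattice $\operatorname{Hom}(\operatorname{Pic}(X),\mathbf Z)$ has covolume one. Let $\mathrm D_1\subset\operatorname{Pic}(X)^\vee_{\mathbf R}$ be a finite union of compact polyhedra. For $u\in\operatorname{Pic}(X)^\vee_{\mathbf R}$ and $B\ge 1$ put $\mathrm D_B=\mathrm D_1+\log(B)\,u$. For $d\in(\mathbf Z_{>0})^{\Sigma(1)}$ put $\Pi(d)=\prod_\rho d_\rho$, $\Lambda_d=\bigoplus_\rho d_\rho\mathbf Z\subset\mathbf R^{\Sigma(1)}$ and $$N_d(B)=\#\{y\in\Lambda_d\cap T_{\Sigma(1)}(\mathbf R) : h_{\mathcal T,\infty}(y)\in\mathrm D_B\}.$$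 Theorem. There is a constant $C>0$, depending only on $\Sigma$ and $\mathrm D_1$, such that for every $u$ in the interior of the dual $C_{\mathrm{eff}}(X)^\vee\subset\operatorname{Pic}(X)^\vee_{\mathbf R}$ of the effective cone, every $d\in(\mathbf Z_{>0})^{\Sigma(1)}$ and every real $B\ge 1$, the number $N_d(B)$ is finite and $$\left|N_d(B)-\frac{2^t\,\mu_{X,\infty}(X(\mathbf R))\,\nu(\mathrm D_1)\,B^{\langle\omega_X^{-1},u\rangle}}{\Pi(d)}\right|\le C\,B^{\langle\omega_X^{-1},u\rangle-\min_{\rho\in\Sigma(1)}\langle[D_\rho],u\rangle}.$$ In particular (the case $d=(1,\dots,1)$) the same estimate holds for the number of points of $\mathbf Z^{\Sigma(1)}\cap T_{\Sigma(1)}(\mathbf R)$ whose torsor height lies in $\mathrm D_B$. -/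

import Mathlib

open MeasureTheory Set

noncomputable section

/-- A smooth, complete, projective fan in the lattice `N = ℤⁿ`, i.e. the fan of a smooth, projective,
split toric variety `X` of dimension `n`.

`ι` is the set `Σ(1)` of rays, `gen ρ` is the primitive generator of the ray `ρ`. As all cones of a
smooth fan are simplicial, a cone is recorded by the finite set of its rays. -/
structure SmoothProjectiveFan (n : ℕ) (ι : Type*) [Fintype ι] [DecidableEq ι] where
  /-- the primitive generator of a ray -/
  gen : ι → (Fin n → ℤ)
  /-- the cones of the fan, each given by the set of its rays -/
  cones : Set (Finset ι)
  /-- each ray is a cone of the fan -/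
  ray_mem : ∀ ρ, {ρ} ∈ cones
  /-- a face of a cone is a cone of the fan -/
  face_mem : ∀ σ ∈ cones, ∀ τ ⊆ σ, τ ∈ cones
  /-- smoothness: the generators of a cone are part of a `ℤ`-basis of `N` -/
  smooth : ∀ σ ∈ cones, ∃ (b : Module.Basis (Fin n) ℤ (Fin n → ℤ)) (e : σ ↪ Fin n),
    ∀ ρ : σ, b (e ρ) = gen ρ
  /-- two cones in `N_ℝ` meet along the common face spanned by their common rays -/
  inter : ∀ σ ∈ cones, ∀ τ ∈ cones, ∀ x : Fin n → ℝ,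
    (∃ c : ι → ℝ, (∀ ρ, 0 ≤ c ρ) ∧ x = ∑ ρ ∈ σ, c ρ • (fun i => (gen ρ i : ℝ))) →
    (∃ c : ι → ℝ, (∀ ρ, 0 ≤ c ρ) ∧ x = ∑ ρ ∈ τ, c ρ • (fun i => (gen ρ i : ℝ))) →
    ∃ c : ι → ℝ, (∀ ρ, 0 ≤ c ρ) ∧ x = ∑ ρ ∈ σ ∩ τ, c ρ • (fun i => (gen ρ i : ℝ))
  /-- completeness: the cones cover `N_ℝ` -/
  complete : ∀ x : Fin n → ℝ, ∃ σ ∈ cones,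
    ∃ c : ι → ℝ, (∀ ρ, 0 ≤ c ρ) ∧ x = ∑ ρ ∈ σ, c ρ • (fun i => (gen ρ i : ℝ))
  /-- projectivity: some divisor `∑ a_ρ D_ρ` has a strictly convex support function (is ample) -/
  projective : ∃ a : ι → ℤ, ∀ σ ∈ cones, σ.card = n →
    ∃ m : Module.Dual ℤ (Fin n → ℤ), (∀ ρ ∈ σ, m (gen ρ) = a ρ) ∧ ∀ ρ ∉ σ, m (gen ρ) < a ρ

namespace SmoothProjectiveFan

variable {n : ℕ} {ι : Type*} [Fintype ι] [DecidableEq ι] (F : SmoothProjectiveFan n ι)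

/-! ### Divisors and the Picard group -/

/-- The divisor `∑ ⟨m, n_ρ⟩ D_ρ` of the character `χ^m` of the torus, for `m` in `M = Hom(N, ℤ)`. -/
def divChar : Module.Dual ℤ (Fin n → ℤ) →ₗ[ℤ] (ι → ℤ) :=
  LinearMap.pi fun ρ => LinearMap.applyₗ (F.gen ρ)

/-- `Pic(X) = ℤ^{Σ(1)} / M`: torus invariant divisors modulo divisors of characters. -/
abbrev Pic : Type _ := (ι → ℤ) ⧸ LinearMap.range F.divChar

/-- `π : Div_T(X) = ℤ^{Σ(1)} → Pic(X)`. -/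
def toPic : (ι → ℤ) →ₗ[ℤ] F.Pic := (LinearMap.range F.divChar).mkQ

/-- The class `[D_ρ]` of the invariant prime divisor of the ray `ρ`. -/
def classD (ρ : ι) : F.Pic := F.toPic (Pi.single ρ 1)

/-- The anticanonical class `ω_X⁻¹ = ∑ [D_ρ]`. -/
def antican : F.Pic := ∑ ρ, F.classD ρ

/-- The rank `t` of `Pic(X)`. -/
def picRank : ℕ := Module.finrank ℤ F.Pic

/-- A class is effective when it contains an effective torus invariant divisor. -/
def IsEffective (L : F.Pic) : Prop := ∃ a : ι → ℤ, 0 ≤ a ∧ F.toPic a = L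

/-- `Pic(X)^∨_ℝ = Hom(Pic(X), ℝ)`. -/
abbrev PicDual : Type _ := F.Pic →ₗ[ℤ] ℝ

/-- The usual topology of the finite-dimensional real vector space `Pic(X)^∨_ℝ`. -/
instance picDualTopology : TopologicalSpace F.PicDual :=
  TopologicalSpace.induced (fun v (L : F.Pic) => v L) inferInstance

instance picDualMeasurableSpace : MeasurableSpace F.PicDual := borel _

/-- The dual `C_eff(X)^∨` of the effective cone. -/
def effDual : Set F.PicDual := {v | ∀ L, F.IsEffective L → 0 ≤ v L}

/-- Compact polyhedra of `Pic(X)^∨_ℝ`: compact finite intersections of closed half-spaces. -/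
def IsCompactPolyhedron (P : Set F.PicDual) : Prop :=
  IsCompact P ∧ ∃ (k : ℕ) (f : Fin k → (F.PicDual →ₗ[ℝ] ℝ)) (c : Fin k → ℝ),
    P = {v | ∀ i, f i v ≤ c i}

/-- `D_B = D + log(B) u`. -/
def translate (D : Set F.PicDual) (u : F.PicDual) (B : ℝ) : Set F.PicDual :=
  (fun v => v + Real.log B • u) '' D

/-! ### Maximal cones -/

/-- The maximal (that is, `n`-dimensional) cones of the fan. -/
def MaxCone : Type _ := {σ : Finset ι // σ ∈ F.cones ∧ σ.card = n}

theorem exists_coneBasis (σ : F.MaxCone) :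
    ∃ b : Module.Basis σ.1 ℤ (Fin n → ℤ), ∀ ρ : σ.1, b ρ = F.gen ρ := by
  obtain ⟨b, e, he⟩ := F.smooth σ.1 σ.2.1
  have hbij : Function.Bijective e :=
    (Fintype.bijective_iff_injective_and_card e).2 ⟨e.injective, by simp [σ.2.2]⟩
  refine ⟨b.reindex (Equiv.ofBijective e hbij).symm, fun ρ => ?_⟩
  simp [he]

/-- The `ℤ`-basis of `N` formed by the generators of a maximal cone. -/
def coneBasis (σ : F.MaxCone) : Module.Basis σ.1 ℤ (Fin n → ℤ) := (F.exists_coneBasis σ).choose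

theorem coneBasis_apply (σ : F.MaxCone) (ρ : σ.1) : F.coneBasis σ ρ = F.gen ρ :=
  (F.exists_coneBasis σ).choose_spec ρ

/-- For a divisor `a`, the character `m_σ` with `⟨m_σ, n_ρ⟩ = a_ρ` for all rays `ρ` of `σ`. -/
def localChar (σ : F.MaxCone) : (ι → ℤ) →ₗ[ℤ] Module.Dual ℤ (Fin n → ℤ) :=
  ((F.coneBasis σ).constr ℤ).toLinearMap ∘ₗ LinearMap.funLeft ℤ ℤ (fun ρ : σ.1 => (ρ : ι))

theorem localChar_gen (σ : F.MaxCone) (a : ι → ℤ) (ρ : ι) (hρ : ρ ∈ σ.1) :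
    F.localChar σ a (F.gen ρ) = a ρ := by
  have h := (F.coneBasis σ).constr_basis ℤ (fun ρ : σ.1 => a ρ) ⟨ρ, hρ⟩
  rw [coneBasis_apply] at h
  exact h

theorem localChar_divChar (σ : F.MaxCone) (m : Module.Dual ℤ (Fin n → ℤ)) :
    F.localChar σ (F.divChar m) = m := by
  refine (F.coneBasis σ).ext fun ρ => ?_
  rw [coneBasis_apply, localChar_gen _ _ _ _ ρ.2]
  rfl

/-- The unique divisor `D(σ) = D - div(χ^{m_σ})` linearly equivalent to `D` whose support contains
no `D_ρ` with `ρ ∈ σ`; it only depends on the class of `D`. -/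
def reduced (σ : F.MaxCone) : F.Pic →ₗ[ℤ] (ι → ℤ) :=
  (LinearMap.range F.divChar).liftQ (LinearMap.id - F.divChar ∘ₗ F.localChar σ) (by
    rintro _ ⟨m, rfl⟩
    simp [localChar_divChar])

theorem reduced_toPic (σ : F.MaxCone) (a : ι → ℤ) :
    F.reduced σ (F.toPic a) = a - F.divChar (F.localChar σ a) := rfl

theorem toPic_reduced (σ : F.MaxCone) (L : F.Pic) : F.toPic (F.reduced σ L) = L := by
  obtain ⟨a, rfl⟩ : ∃ a, F.toPic a = L := Submodule.mkQ_surjective _ L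
  rw [reduced_toPic, map_sub, sub_eq_self]
  exact (Submodule.Quotient.mk_eq_zero _).2 ⟨_, rfl⟩

/-- A complete fan has a cone of dimension `n`. -/
theorem nonempty_maxCone : Nonempty F.MaxCone := by
  by_contra hne
  let v : ι → Fin n → ℝ := fun ρ i => (F.gen ρ i : ℝ)
  have hcov : ⋃ σ : {σ : Finset ι // σ ∈ F.cones},
      (Submodule.span ℝ ((σ.1.image v : Finset (Fin n → ℝ)) : Set (Fin n → ℝ)) :
        Set (Fin n → ℝ)) = Set.univ := by
    refine Set.eq_univ_of_forall fun x => Set.mem_iUnion.2 ?_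
    obtain ⟨σ, hσ, c, -, rfl⟩ := F.complete x
    refine ⟨⟨σ, hσ⟩, Submodule.sum_mem _ fun ρ hρ => Submodule.smul_mem _ _ ?_⟩
    exact Submodule.subset_span (Finset.mem_coe.2 (Finset.mem_image_of_mem v hρ))
  obtain ⟨⟨σ, hσ⟩, htop⟩ := Subspace.exists_eq_top_of_iUnion_eq_univ hcov
  have h1 : n ≤ σ.card := by
    have h := finrank_span_finset_le_card (R := ℝ) (σ.image v)
    rw [Set.finrank, htop, finrank_top, Module.finrank_fin_fun] at h
    exact h.trans Finset.card_image_le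
  have h2 : σ.card ≤ n := by
    obtain ⟨-, e, -⟩ := F.smooth σ hσ
    simpa using Fintype.card_le_of_embedding e
  exact hne ⟨⟨σ, hσ, le_antisymm h2 h1⟩⟩

instance pic_free : Module.Free ℤ F.Pic := by
  obtain ⟨σ⟩ := F.nonempty_maxCone
  have hinj : Function.Injective (F.reduced σ) :=
    Function.LeftInverse.injective (F.toPic_reduced σ)
  have : Module.IsTorsionFree ℤ F.Pic :=
    hinj.moduleIsTorsionFree _ (fun c x => map_smul _ c x)
  infer_instance

/-! ### The measure on `Pic(X)^∨_ℝ` -/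

/-- The Haar measure on `Pic(X)^∨_ℝ` for which the dual lattice of `Pic(X)` has covolume one:
Lebesgue measure in the coordinates given by a `ℤ`-basis of `Pic(X)`. -/
def picHaar : Measure F.PicDual :=
  Measure.map ((Module.Free.chooseBasis ℤ F.Pic).constr ℝ) volume

/-- The measure `ν(D) = ∫_D e^{⟨ω_X⁻¹, y⟩} dy`. -/
def nu : Measure F.PicDual :=
  F.picHaar.withDensity fun v => ENNReal.ofReal (Real.exp (v F.antican))

/-! ### The universal torsor and its height -/

/-- The real points of the universal torsor `𝒯 ⊆ 𝔸^{Σ(1)}`: the rays whose coordinate vanishes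
all lie in a common cone. -/
def torsor : Set (ι → ℝ) := {y | ∃ σ ∈ F.cones, ∀ ρ ∉ σ, y ρ ≠ 0}

/-- `C_{σ,∞}` pulled back to the torsor: the points lying over the affine chart `U_σ` at which
`|χ^m| ≤ 1` for all `m ∈ σ^∨ ∩ M`. -/
def compactPart (σ : F.MaxCone) : Set (ι → ℝ) :=
  {y | (∀ ρ ∉ σ.1, y ρ ≠ 0) ∧ ∀ m : Module.Dual ℤ (Fin n → ℤ), (∀ ρ ∈ σ.1, 0 ≤ m (F.gen ρ)) →
    |∏ ρ, y ρ ^ m (F.gen ρ)| ≤ 1}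

/-- The linear form `[D] ↦ log |y^{D(σ)}|`. -/
def chartHeight (σ : F.MaxCone) (y : ι → ℝ) : F.PicDual :=
  ∑ ρ, Real.log |y ρ| •
    ((Int.castAddHom ℝ).toIntLinearMap ∘ₗ LinearMap.proj ρ ∘ₗ F.reduced σ)

open Classical in
/-- The real height `h_{𝒯,∞} : 𝒯(ℝ) → Pic(X)^∨_ℝ`. The local generator of `𝒪(D)` on `U_σ` has norm
one on `C_{σ,∞}`, so `h_{𝒯,∞}(y)([D]) = log |y^{D(σ)}|` for any maximal cone `σ` such that `y` lies
over `C_{σ,∞}`. The sets `C_{σ,∞}` cover `X(ℝ)` and the value does not depend on the choice of `σ`;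
off the torsor the value is `0` by convention. -/
def torsorHeight (y : ι → ℝ) : F.PicDual :=
  if h : ∃ σ, y ∈ F.compactPart σ then F.chartHeight h.choose y else 0

/-! ### The real points of `X` and the measure `μ_{X,∞}` -/

/-- Two points of `𝒯(ℝ)` are equivalent when they differ by the action of an element `s` of
`T_NS(ℝ) = Hom(Pic(X), ℝˣ)`, which acts on the coordinate `ρ` through `s([D_ρ])`. -/
def torsorSetoid : Setoid F.torsor where
  r y z := ∃ s : Multiplicative F.Pic →* ℝˣ,
    ∀ ρ, z.1 ρ = (s (Multiplicative.ofAdd (F.classD ρ)) : ℝ) * y.1 ρ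
  iseqv :=
    { refl := fun y => ⟨1, fun ρ => by simp⟩
      symm := by
        rintro y z ⟨s, hs⟩
        exact ⟨s⁻¹, fun ρ => by simp [hs]⟩
      trans := by
        rintro x y z ⟨s, hs⟩ ⟨s', hs'⟩
        exact ⟨s' * s, fun ρ => by simp [hs, hs', mul_assoc]⟩ }

/-- The space of real points `X(ℝ) = 𝒯(ℝ) / T_NS(ℝ)`, with the quotient topology. -/
abbrev RealPoints : Type _ := Quotient F.torsorSetoid

instance realPointsMeasurableSpace : MeasurableSpace F.RealPoints := borel _

/-- The section over `U_σ(ℝ) = ℝ^{σ(1)}` of the torsor: all coordinates outside `σ` are `1`. -/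
def chartLift (σ : F.MaxCone) (x : σ.1 → ℝ) : F.torsor :=
  ⟨fun ρ => if h : ρ ∈ σ.1 then x ⟨ρ, h⟩ else 1,
    σ.1, σ.2.1, fun ρ hρ => by simp [hρ]⟩

/-- The chart `U_σ(ℝ) = ℝ^{σ(1)} → X(ℝ)`, in the coordinates given by the `ℤ`-basis of `M` dual to the
generators of `σ`. -/
def chart (σ : F.MaxCone) (x : σ.1 → ℝ) : F.RealPoints :=
  Quotient.mk F.torsorSetoid (F.chartLift σ x)

/-- The measure `μ_{X,∞}` on `X(ℝ)` attached to the norm on `ω_X⁻¹`. In each chart `U_σ` it is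
`‖∂/∂x_1 ∧ … ∧ ∂/∂x_n‖ dx_1 … dx_n`, and the norm of this local generator of `ω_X⁻¹` at `x` is
`exp (- h_{𝒯,∞}(x̃)(ω_X⁻¹))`, for `x̃` the lift of `x` with coordinates `1` outside `σ`. These measures
agree on overlaps, so their supremum is the measure on `X(ℝ)` which restricts to each of them. -/
def muReal : Measure F.RealPoints :=
  ⨆ σ : F.MaxCone, Measure.map (F.chart σ) ((volume : Measure (σ.1 → ℝ)).withDensity fun x =>
    ENNReal.ofReal (Real.exp (-(F.torsorHeight (F.chartLift σ x).1 F.antican))))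

/-! ### The counting function -/

/-- The points of `Λ_d = ⊕ d_ρ ℤ` which lie in the torus `T_{Σ(1)}(ℝ)` and whose torsor height lies
in `D_B`. -/
def latticePoints (D : Set F.PicDual) (u : F.PicDual) (d : ι → ℕ) (B : ℝ) : Set (ι → ℝ) :=
  {y | (∃ z : ι → ℤ, ∀ ρ, y ρ = d ρ * z ρ) ∧ (∀ ρ, y ρ ≠ 0) ∧
    F.torsorHeight y ∈ F.translate D u B}

end SmoothProjectiveFan

end

set_option linter.unusedSectionVars false

/-! Dividing the coordinate `y ρ` by `B ^ u (F.classD ρ)` is the action of an element of the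
Néron-Severi torus. The height is equivariant under it and moves by `-log B • u`
(`torsorHeight_eq_add`). So the points to be counted correspond to the points of a grid with steps
`ε ρ = d ρ / B ^ u (F.classD ρ)` in one fixed region: the points of the torus with height in `D₁`
(`latticePoints_eq_image`).

This region is bounded, because `log |y ρ| ≤ h(y)([D_ρ])` (`le_logHeight_classD`) and `D₁` is
compact. It is a finite union of pieces, one for each maximal cone, polyhedron and choice of signs.
In logarithmic coordinates each piece is convex, so lines parallel to the axes meet it in intervals.
For such a region the number of grid points off the coordinate hyperplanes, times `∏ ε`, is the
volume up to `O(∑ ε)`, uniformly in `ε` (`TameRegion.exists_abs_card_sub_le`): rounding one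
coordinate down to the grid changes the volume by `O(ε i)`, and once all are rounded the region is a
union of grid cells. Division by `∏ ε` gives the main term and an error `∑ ε ρ / ∏ ε`, bounded by
the stated power of `B`.

The volume of the region is `2 ^ t * ν(D₁) * μ(X(ℝ))` (`volume_torusSet`): the torus fibres over a
chart of `X(ℝ)` with fibre the Néron-Severi torus, and the logarithms of the fibre coordinates turn
the fibre integral into `2 ^ t` times `ν` of a translate of `D₁`. The translation factor is the
density of `μ` in the chart. -/

/-! ### Counting points of a lattice in a box-like region -/

/-- The largest multiple of `e` which is at most `t`. -/
noncomputable def gridFloor (e t : ℝ) : ℝ := e * ⌊t / e⌋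

theorem gridFloor_le {e : ℝ} (he : 0 < e) (t : ℝ) : gridFloor e t ≤ t := by
  have h := mul_le_mul_of_nonneg_left (Int.floor_le (t / e)) he.le
  rwa [mul_div_cancel₀ _ he.ne'] at h

theorem lt_gridFloor_add {e : ℝ} (he : 0 < e) (t : ℝ) : t < gridFloor e t + e := by
  have h := mul_lt_mul_of_pos_left (Int.lt_floor_add_one (t / e)) he
  rw [mul_div_cancel₀ _ he.ne'] at h
  simpa [gridFloor, mul_add] using h

theorem floor_le_floor_of_gridFloor_le {e : ℝ} (he : 0 < e) {s t : ℝ} (h : gridFloor e s ≤ t) :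
    ⌊s / e⌋ ≤ ⌊t / e⌋ := by
  rw [Int.le_floor, le_div_iff₀ he, mul_comm]
  exact h

theorem measurable_gridFloor (e : ℝ) : Measurable (gridFloor e) := by
  unfold gridFloor
  fun_prop

/-- The hypothesis is symmetric in `t` and `t'`, so all of `D` lies in one grid cell. -/
theorem volume_le_of_floor_eq {e : ℝ} (he : 0 < e) {D : Set ℝ}
    (h : ∀ t ∈ D, ∀ t' ∈ D, ⌊t / e⌋ ≤ ⌊t' / e⌋) : volume D ≤ ENNReal.ofReal e := by
  rcases D.eq_empty_or_nonempty with rfl | ⟨s, hs⟩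
  · simp
  have hsub : D ⊆ Ico (gridFloor e s) (gridFloor e s + e) := by
    intro t ht
    have heq : gridFloor e s = gridFloor e t := by
      rw [gridFloor, gridFloor, le_antisymm (h s hs t ht) (h t ht s hs)]
    rw [heq]
    exact ⟨gridFloor_le he t, lt_gridFloor_add he t⟩
  refine (measure_mono hsub).trans ?_
  simp

/-- Rounding down changes membership in an interval only across an endpoint. The points leaving `J`
fill at most part of one cell, and so do those entering it. -/
theorem volume_gridFloor_mem_ne_le {e : ℝ} (he : 0 < e) {J : Set ℝ} (hJ : J.OrdConnected) :
    volume {t | ¬(gridFloor e t ∈ J ↔ t ∈ J)} ≤ 2 * ENNReal.ofReal e := by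
  have hsub : {t | ¬(gridFloor e t ∈ J ↔ t ∈ J)} ⊆
      {t | gridFloor e t ∈ J ∧ t ∉ J} ∪ {t | gridFloor e t ∉ J ∧ t ∈ J} := by
    intro t ht
    simp only [mem_ofPred_eq, mem_union] at ht ⊢
    tauto
  refine (measure_mono hsub).trans ((measure_union_le _ _).trans ?_)
  rw [two_mul]
  refine add_le_add (volume_le_of_floor_eq he ?_) (volume_le_of_floor_eq he ?_)
  · rintro t ⟨ht, ht'⟩ s ⟨hs, hs'⟩
    refine floor_le_floor_of_gridFloor_le he (not_lt.1 fun hlt => hs' ?_)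
    exact hJ.out hs ht ⟨gridFloor_le he s, hlt.le⟩
  · rintro t ⟨ht, ht'⟩ s ⟨hs, hs'⟩
    refine floor_le_floor_of_gridFloor_le he (not_lt.1 fun hlt => ht ?_)
    exact hJ.out hs' ht' ⟨hlt.le, gridFloor_le he t⟩

section Counting

variable {ι : Type*} [Fintype ι] [DecidableEq ι]

/-- Fubini in the direction `i`. The fibre bound is written as `K` times the side of the cube, so
that `A` can be compared with `K` times the indicator of the cube. -/
theorem volume_le_of_fiber_le {A : Set (ι → ℝ)} (hA : MeasurableSet A) {b : ℝ}
    (hb : ∀ y ∈ A, ∀ i, y i ∈ Icc (-b) b) (i : ι) (K : ENNReal)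
    (hK : ∀ y, volume {t | Function.update y i t ∈ A} ≤ K * ENNReal.ofReal (2 * b)) :
    volume A ≤ K * ENNReal.ofReal (2 * b) ^ Fintype.card ι := by
  set Q : Set (ι → ℝ) := univ.pi fun _ => Icc (-b) b with hQ
  have hQm : MeasurableSet Q := MeasurableSet.univ_pi fun _ => measurableSet_Icc
  have hbb : b - -b = 2 * b := by ring
  have hvQ : volume Q = ENNReal.ofReal (2 * b) ^ Fintype.card ι := by
    rw [hQ, volume_pi_pi]
    simp [hbb]
  have key := lintegral_le_of_lmarginal_le (μ := fun _ : ι => (volume : Measure ℝ)) {i}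
    (f := A.indicator 1) (g := fun y => K * Q.indicator 1 y)
    (measurable_one.indicator hA) ((measurable_one.indicator hQm).const_mul K) ?_
  · rw [lintegral_const_mul _ (measurable_one.indicator hQm), ← volume_pi,
      lintegral_indicator_one hA, lintegral_indicator_one hQm, hvQ] at key
    exact key
  intro y
  rw [lmarginal_singleton, lmarginal_singleton]
  have hL : ∫⁻ t, A.indicator 1 (Function.update y i t) =
      volume {t | Function.update y i t ∈ A} := by
    have : MeasurableSet {t | Function.update y i t ∈ A} := by
      exact (measurable_update y) hA
    rw [← lintegral_indicator_one this]
    rfl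
  change ∫⁻ t, A.indicator 1 (Function.update y i t) ≤ _
  rw [hL]
  by_cases hy : ∀ j ≠ i, y j ∈ Icc (-b) b
  · refine (hK y).trans (le_of_eq ?_)
    have : ∀ t, (fun y => K * Q.indicator 1 y) (Function.update y i t) =
        (Icc (-b) b).indicator (fun _ => K) t := by
      intro t
      have hiff : Function.update y i t ∈ Q ↔ t ∈ Icc (-b) b := by
        rw [hQ, mem_univ_pi]
        constructor
        · intro h
          simpa using h i
        · intro h j
          rcases eq_or_ne j i with rfl | hj
          · simpa using h
          · simpa [hj] using hy j hj
      by_cases ht : t ∈ Icc (-b) b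
      · simp only [indicator_of_mem ht, indicator_of_mem (hiff.2 ht), Pi.one_apply, mul_one]
      · simp only [indicator_of_notMem ht, indicator_of_notMem (mt hiff.1 ht), mul_zero]
    simp_rw [this]
    rw [lintegral_indicator_const measurableSet_Icc, Real.volume_Icc, hbb]
  · push Not at hy
    obtain ⟨j, hj, hyj⟩ := hy
    have : {t | Function.update y i t ∈ A} = ∅ := by
      refine eq_empty_of_forall_notMem fun t ht => hyj ?_
      simpa [hj] using hb _ ht j
    rw [this]
    simp

/-- Round the coordinates in `S` down to multiples of `ε`. -/
noncomputable def snap (ε : ι → ℝ) (S : Finset ι) (y : ι → ℝ) : ι → ℝ :=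
  fun i => if i ∈ S then gridFloor (ε i) (y i) else y i

theorem measurable_snap (ε : ι → ℝ) (S : Finset ι) : Measurable (snap ε S) := by
  refine measurable_pi_lambda _ fun i => ?_
  unfold snap
  split_ifs
  · exact (measurable_gridFloor _).comp (measurable_pi_apply i)
  · exact measurable_pi_apply i

theorem snap_update_of_notMem (ε : ι → ℝ) {S : Finset ι} {i : ι} (hi : i ∉ S) (y : ι → ℝ) (t : ℝ) :
    snap ε S (Function.update y i t) = Function.update (snap ε S y) i t := by
  ext j
  rcases eq_or_ne j i with rfl | hj
  · simp [snap, hi]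
  · simp [snap, hj]

theorem snap_insert_update (ε : ι → ℝ) {S : Finset ι} {i : ι} (y : ι → ℝ) (t : ℝ) :
    snap ε (insert i S) (Function.update y i t) =
      Function.update (snap ε S y) i (gridFloor (ε i) t) := by
  ext j
  rcases eq_or_ne j i with rfl | hj
  · simp [snap]
  · simp [snap, hj]

theorem abs_le_of_snap {ε : ι → ℝ} (hε : ∀ i, 0 < ε i) {S : Finset ι} {y : ι → ℝ} {c : ℝ} {i : ι}
    (hεc : ε i ≤ c) (h : |snap ε S y i| ≤ c) : y i ∈ Icc (-(2 * c)) (2 * c) := by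
  have h1 := gridFloor_le (hε i) (y i)
  have h2 := lt_gridFloor_add (hε i) (y i)
  have h3 := hε i
  rw [abs_le] at h
  unfold snap at h
  split_ifs at h <;> constructor <;> linarith [h.1, h.2]

/-- A region which is a union of sets whose intersections with lines parallel to the axes are
intervals, and which lies in a box. -/
structure TameRegion (κ : Type*) (R : κ → Set (ι → ℝ)) (c : ℝ) : Prop where
  measurable : ∀ a, MeasurableSet (R a)
  ordConnected : ∀ a y i, {t | Function.update y i t ∈ R a}.OrdConnected
  bound : ∀ a, ∀ y ∈ R a, ∀ i, |y i| ≤ c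

variable {κ : Type*} [Fintype κ] {R : κ → Set (ι → ℝ)} {c : ℝ}

theorem TameRegion.measurableSet_iUnion (hR : TameRegion κ R c) : MeasurableSet (⋃ a, R a) :=
  MeasurableSet.iUnion hR.measurable

theorem TameRegion.mem_Icc (hR : TameRegion κ R c) {ε : ι → ℝ} (hε : ∀ i, 0 < ε i)
    (hεc : ∀ i, ε i ≤ c) {S : Finset ι} {y : ι → ℝ} (hy : snap ε S y ∈ ⋃ a, R a) (i : ι) :
    y i ∈ Icc (-(2 * c)) (2 * c) := by
  obtain ⟨a, ha⟩ := mem_iUnion.1 hy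
  exact abs_le_of_snap hε (hεc i) (hR.bound a _ ha i)

theorem volume_lt_top_of_forall_mem_Icc {A : Set (ι → ℝ)} {b : ℝ}
    (h : ∀ y ∈ A, ∀ i, y i ∈ Icc (-b) b) : volume A < ⊤ := by
  refine (measure_mono (t := univ.pi fun _ => Icc (-b) b) fun y hy i _ => h y hy i).trans_lt ?_
  rw [volume_pi_pi]
  exact ENNReal.prod_lt_top fun i _ => by simp

/-- On a line in direction `i` the symmetric difference consists of points whose rounding changes
membership in one of the `card κ` intervals, so it has measure at most `card κ * (2 * ε i)`. The
cube has side `4 * c` since rounding moves a coordinate by at most `c`. -/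
theorem TameRegion.abs_volume_snap_insert_sub_le (hR : TameRegion κ R c) (hc : 0 < c) {ε : ι → ℝ}
    (hε : ∀ i, 0 < ε i) (hεc : ∀ i, ε i ≤ c) {S : Finset ι} {i : ι} (hi : i ∉ S) :
    |volume.real (snap ε (insert i S) ⁻¹' ⋃ a, R a) - volume.real (snap ε S ⁻¹' ⋃ a, R a)| ≤
      Fintype.card κ * (2 * ε i) / (4 * c) * (4 * c) ^ Fintype.card ι := by
  have hm : ∀ S, MeasurableSet (snap ε S ⁻¹' ⋃ a, R a) := fun S =>
    measurable_snap ε S hR.measurableSet_iUnion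
  have hfin : ∀ S, volume (snap ε S ⁻¹' ⋃ a, R a) ≠ ⊤ := fun S =>
    (volume_lt_top_of_forall_mem_Icc fun y hy i => hR.mem_Icc hε hεc hy i).ne
  refine (abs_measureReal_sub_le_measureReal_symmDiff' (hm _).nullMeasurableSet
    (hm _).nullMeasurableSet (hfin _) (hfin _)).trans ?_
  set A := symmDiff (snap ε (insert i S) ⁻¹' ⋃ a, R a) (snap ε S ⁻¹' ⋃ a, R a) with hAdef
  have hA : MeasurableSet A := (hm _).symmDiff (hm _)
  have h4 : 2 * (2 * c) = 4 * c := by ring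
  have hvol := volume_le_of_fiber_le hA (b := 2 * c) ?_ i
    (ENNReal.ofReal (Fintype.card κ * (2 * ε i) / (4 * c))) ?_
  · rw [h4, ← ENNReal.ofReal_pow (by positivity), ← ENNReal.ofReal_mul
      (by have := hε i; positivity)] at hvol
    exact ENNReal.toReal_le_of_le_ofReal (by have := hε i; positivity) hvol
  · rintro y (hy | hy) j
    · exact hR.mem_Icc hε hεc hy.1 j
    · exact hR.mem_Icc hε hεc hy.1 j
  · intro y
    have hsub : {t | Function.update y i t ∈ A} ⊆
        ⋃ a, {t | ¬(gridFloor (ε i) t ∈ {t | Function.update (snap ε S y) i t ∈ R a} ↔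
          t ∈ {t | Function.update (snap ε S y) i t ∈ R a})} := by
      intro t ht
      simp only [mem_ofPred_eq, hAdef, mem_symmDiff, mem_preimage, snap_insert_update,
        snap_update_of_notMem ε hi, mem_iUnion] at ht ⊢
      by_contra hcon
      push Not at hcon
      simp only [hcon] at ht
      tauto
    refine (measure_mono hsub).trans ((measure_iUnion_fintype_le _ _).trans ?_)
    refine (Finset.sum_le_sum fun a _ => volume_gridFloor_mem_ne_le (hε i)
      (hR.ordConnected a (snap ε S y) i)).trans (le_of_eq ?_)
    rw [h4, ← ENNReal.ofReal_mul (by have := hε i; positivity), div_mul_cancel₀ _ (by positivity)]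
    rw [Finset.sum_const, Finset.card_univ, nsmul_eq_mul, ENNReal.ofReal_mul (by positivity),
      ENNReal.ofReal_mul (by positivity)]
    simp

theorem TameRegion.abs_volume_snap_sub_le (hR : TameRegion κ R c) (hc : 0 < c) {ε : ι → ℝ}
    (hε : ∀ i, 0 < ε i) (hεc : ∀ i, ε i ≤ c) (S : Finset ι) :
    |volume.real (snap ε S ⁻¹' ⋃ a, R a) - volume.real (⋃ a, R a)| ≤
      ∑ i ∈ S, Fintype.card κ * (2 * ε i) / (4 * c) * (4 * c) ^ Fintype.card ι := by
  induction S using Finset.induction_on with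
  | empty =>
    have : snap ε ∅ = id := by
      ext y i
      simp [snap]
    simp [this]
  | insert i S hi ih =>
    rw [Finset.sum_insert hi]
    refine (abs_sub_le _ (volume.real (snap ε S ⁻¹' ⋃ a, R a)) _).trans ?_
    exact add_le_add (hR.abs_volume_snap_insert_sub_le hc hε hεc hi) ih

theorem finite_gridPoints {ε : ι → ℝ} (hε : ∀ i, 0 < ε i) {A : Set (ι → ℝ)} {c : ℝ}
    (hA : ∀ y ∈ A, ∀ i, |y i| ≤ c) : {z : ι → ℤ | (fun i => ε i * z i) ∈ A}.Finite := by
  refine (Set.finite_Icc (fun i => -⌈c / ε i⌉) (fun i => ⌈c / ε i⌉)).subset fun z hz => ?_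
  have h : ∀ i, |(z i : ℝ)| ≤ ⌈c / ε i⌉ := by
    intro i
    refine le_trans ?_ (Int.le_ceil _)
    rw [le_div_iff₀ (hε i)]
    have := hA _ hz i
    rwa [abs_mul, abs_of_pos (hε i), mul_comm] at this
  constructor <;> intro i
  · have := (abs_le.1 (h i)).1
    exact_mod_cast this
  · have := (abs_le.1 (h i)).2
    exact_mod_cast this

/-- Full rounding is constant on half-open grid cells, so the preimage is a disjoint union of cells
of volume `∏ ε`, one for each grid point of `A`. -/
theorem volume_snap_univ {ε : ι → ℝ} (hε : ∀ i, 0 < ε i) {A : Set (ι → ℝ)}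
    (hfin : {z : ι → ℤ | (fun i => ε i * z i) ∈ A}.Finite) :
    volume.real (snap ε Finset.univ ⁻¹' A) =
      {z : ι → ℤ | (fun i => ε i * z i) ∈ A}.ncard * ∏ i, ε i := by
  let box : (ι → ℤ) → Set (ι → ℝ) := fun z => univ.pi fun i => Ico (ε i * z i) (ε i * z i + ε i)
  have hbox : ∀ z y, y ∈ box z ↔ ∀ i, ⌊y i / ε i⌋ = z i := by
    intro z y
    simp only [box, mem_univ_pi, mem_Ico, Int.floor_eq_iff]
    refine forall_congr' fun i => and_congr ?_ ?_
    · rw [le_div_iff₀ (hε i), mul_comm]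
    · rw [div_lt_iff₀ (hε i), add_mul, one_mul, mul_comm]
  have hsnap : ∀ y, snap ε Finset.univ y = fun i => ε i * ((⌊y i / ε i⌋ : ℤ) : ℝ) := by
    intro y
    ext i
    simp [snap, gridFloor]
  have hset : snap ε Finset.univ ⁻¹' A = ⋃ z ∈ hfin.toFinset, box z := by
    ext y
    simp only [mem_preimage, Finite.mem_toFinset, mem_iUnion, mem_ofPred_eq, exists_prop, hbox]
    constructor
    · intro h
      exact ⟨fun i => ⌊y i / ε i⌋, hsnap y ▸ h, fun i => rfl⟩
    · rintro ⟨z, hz, h⟩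
      have : z = fun i => ⌊y i / ε i⌋ := funext fun i => (h i).symm
      subst this
      exact hsnap y ▸ hz
  have hvol : ∀ z, volume (box z) = ENNReal.ofReal (∏ i, ε i) := by
    intro z
    rw [volume_pi_pi, ENNReal.ofReal_prod_of_nonneg fun i _ => (hε i).le]
    simp
  rw [hset, measureReal_def, measure_biUnion_finset]
  · simp only [hvol, Finset.sum_const, nsmul_eq_mul, ENNReal.toReal_mul, ENNReal.toReal_natCast]
    rw [ENNReal.toReal_ofReal (Finset.prod_nonneg fun i _ => (hε i).le),
      ncard_eq_toFinset_card _ hfin]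
  · intro z _ z' _ hzz'
    refine Set.disjoint_left.2 fun y hy hy' => hzz' ?_
    ext i
    rw [← (hbox z y).1 hy i, ← (hbox z' y).1 hy' i]
  · exact fun z _ => MeasurableSet.univ_pi fun i => measurableSet_Ico

/-- The number of points of a scaled lattice in a tame region off the coordinate hyperplanes is
its volume divided by the covolume, with an error term which is uniform in the lattice. -/
theorem TameRegion.exists_abs_card_sub_le (hR : TameRegion κ R c) (hc : 0 < c)
    (h0 : ∀ a, ∀ y ∈ R a, ∀ i, y i ≠ 0) :
    ∃ C : ℝ, 0 ≤ C ∧ ∀ ε : ι → ℝ, (∀ i, 0 < ε i) →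
      {z : ι → ℤ | (fun i => ε i * z i) ∈ ⋃ a, R a}.Finite ∧
      |({z : ι → ℤ | (fun i => ε i * z i) ∈ ⋃ a, R a}.ncard : ℝ) * ∏ i, ε i -
        volume.real (⋃ a, R a)| ≤ C * ∑ i, ε i := by
  have hb : ∀ y ∈ ⋃ a, R a, ∀ i, |y i| ≤ c := by
    intro y hy
    obtain ⟨a, ha⟩ := mem_iUnion.1 hy
    exact hR.bound a y ha
  set C₁ : ℝ := Fintype.card κ * 2 / (4 * c) * (4 * c) ^ Fintype.card ι with hC₁
  set V := volume.real (⋃ a, R a) with hV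
  have hV0 : 0 ≤ V := measureReal_nonneg
  have hC0 : 0 ≤ C₁ := by positivity
  -- `C₁` serves when all steps are at most `c`, `V / c` when some step exceeds `c`.
  refine ⟨C₁ + V / c, by positivity, fun ε hε => ⟨finite_gridPoints hε hb, ?_⟩⟩
  have hsum : 0 ≤ ∑ i, ε i := Finset.sum_nonneg fun i _ => (hε i).le
  by_cases hεc : ∀ i, ε i ≤ c
  · rw [← volume_snap_univ hε (finite_gridPoints hε hb)]
    refine (hR.abs_volume_snap_sub_le hc hε hεc Finset.univ).trans ?_
    have : ∑ i, Fintype.card κ * (2 * ε i) / (4 * c) * (4 * c) ^ Fintype.card ι =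
        C₁ * ∑ i, ε i := by
      rw [Finset.mul_sum]
      refine Finset.sum_congr rfl fun i _ => ?_
      rw [hC₁]
      ring
    rw [this, add_mul]
    have : 0 ≤ V / c * ∑ i, ε i := by positivity
    linarith
  -- A grid point with nonzero `j`-th coordinate is now outside the box, so the count is zero and
  -- the volume itself is the error.
  · push Not at hεc
    obtain ⟨j, hj⟩ := hεc
    have hempty : {z : ι → ℤ | (fun i => ε i * z i) ∈ ⋃ a, R a} = ∅ := by
      refine eq_empty_of_forall_notMem fun z hz => ?_
      have h1 : |ε j * (z j : ℝ)| ≤ c := hb _ hz j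
      obtain ⟨a, ha⟩ := mem_iUnion.1 hz
      have h2 : ε j * (z j : ℝ) ≠ 0 := h0 a _ ha j
      have h3 : z j ≠ 0 := fun h => h2 (by simp [h])
      have h4 : (1 : ℝ) ≤ |(z j : ℝ)| := by exact_mod_cast Int.one_le_abs h3
      rw [abs_mul, abs_of_pos (hε j)] at h1
      nlinarith [hε j]
    rw [hempty]
    simp only [ncard_empty, Nat.cast_zero, zero_mul, zero_sub, abs_neg, abs_of_nonneg hV0]
    have h1 : c ≤ ∑ i, ε i :=
      hj.le.trans (Finset.single_le_sum (fun i _ => (hε i).le) (Finset.mem_univ j))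
    calc V = V / c * c := by field_simp
      _ ≤ V / c * ∑ i, ε i := by gcongr
      _ ≤ _ := by
        rw [add_mul]
        have : 0 ≤ C₁ * ∑ i, ε i := by positivity
        linarith

end Counting

/-! ### Lebesgue measure in logarithmic coordinates and change of `ℤ`-basis -/

theorem lintegral_prod_apply_eq_prod {κ : Type*} [Fintype κ] [DecidableEq κ]
    (f : κ → ℝ → ENNReal) (hf : ∀ i, Measurable (f i)) :
    ∫⁻ x : κ → ℝ, ∏ i, f i (x i) = ∏ i, ∫⁻ t, f i t := by
  have hm : Measurable fun x : κ → ℝ => ∏ i, f i (x i) :=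
    Finset.measurable_fun_prod _ fun i _ => (hf i).comp (measurable_pi_apply i)
  have key : ∀ (S : Finset κ) (x : κ → ℝ),
      lmarginal (fun _ => volume) S (fun x : κ → ℝ => ∏ i, f i (x i)) x =
        (∏ i ∈ S, ∫⁻ t, f i t) * ∏ i ∈ Sᶜ, f i (x i) := by
    intro S
    induction S using Finset.induction_on with
    | empty => simp
    | insert i S hi ih =>
      intro x
      rw [lmarginal_insert _ hm hi]
      simp_rw [ih]
      have hi' : i ∈ Sᶜ := Finset.mem_compl.2 hi
      have hprod : ∀ t, ∏ j ∈ Sᶜ, f j (Function.update x i t j) =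
          f i t * ∏ j ∈ (insert i S)ᶜ, f j (x j) := by
        intro t
        rw [← Finset.mul_prod_erase _ _ hi', Finset.compl_insert, Function.update_self]
        congr 1
        refine Finset.prod_congr rfl fun j hj => ?_
        rw [Function.update_of_ne (Finset.ne_of_mem_erase hj)]
      simp_rw [hprod]
      rw [lintegral_const_mul _ ((hf i).mul_const _), lintegral_mul_const _ (hf i),
        Finset.prod_insert hi]
      ring
  rw [volume_pi, lintegral_eq_lmarginal_univ (0 : κ → ℝ), key]
  simp

/-- The factor 2 counts the signs of `t`; it is the source of `2 ^ t` in the theorem. -/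
theorem map_log_abs_volume :
    Measure.map (fun t : ℝ => Real.log |t|) volume =
      volume.withDensity fun x => ENNReal.ofReal (2 * Real.exp x) := by
  have hm : Measurable fun t : ℝ => Real.log |t| := by fun_prop
  have hcont : Continuous fun x : ℝ => 2 * Real.exp x := by fun_prop
  have : IsLocallyFiniteMeasure (volume.withDensity fun x => ENNReal.ofReal (2 * Real.exp x)) :=
    IsLocallyFiniteMeasure.withDensity_ofReal hcont
  refine (Measure.ext_of_Ioc _ _ fun a b hab => ?_).symm
  have hexp := Real.exp_lt_exp.2 hab
  rw [withDensity_apply _ measurableSet_Ioc, Measure.map_apply hm measurableSet_Ioc,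
    ← ofReal_integral_eq_lintegral_ofReal ((hcont.integrableOn_Icc).mono_set Ioc_subset_Icc_self)
      (Filter.Eventually.of_forall fun x => by positivity),
    ← intervalIntegral.integral_of_le hab.le, intervalIntegral.integral_const_mul, integral_exp]
  -- Equality holds only almost everywhere: as `Real.log 0 = 0`, the point 0 may lie in the
  -- preimage.
  have hset : ((fun t : ℝ => Real.log |t|) ⁻¹' Ioc a b) =ᵐ[volume]
      (Ioc (Real.exp a) (Real.exp b) ∪ Ico (-Real.exp b) (-Real.exp a) : Set ℝ) := by
    have h0 : ∀ᵐ t : ℝ, t ≠ 0 := by simp [ae_iff]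
    refine Filter.eventuallyEq_set.2 ?_
    filter_upwards [h0] with t ht
    have habs : 0 < |t| := abs_pos.2 ht
    have ha := Real.exp_pos a
    rw [mem_preimage, mem_Ioc, Real.lt_log_iff_exp_lt habs, Real.log_le_iff_le_exp habs, mem_union, mem_Ioc,
      mem_Ico, lt_abs, abs_le]
    constructor
    · rintro ⟨h | h, h', h''⟩
      · exact Or.inl ⟨h, h''⟩
      · exact Or.inr ⟨h', by linarith⟩
    · rintro (⟨h, h'⟩ | ⟨h, h'⟩)
      · exact ⟨Or.inl h, by linarith, h'⟩
      · exact ⟨Or.inr (by linarith), h, by linarith⟩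
  rw [measure_congr hset, measure_union _ measurableSet_Ico, Real.volume_Ioc, Real.volume_Ico,
    ← ENNReal.ofReal_add (by linarith) (by linarith)]
  · congr 1
    ring
  · refine Set.disjoint_left.2 fun t h h' => ?_
    have ha := Real.exp_pos a
    linarith [h.1, h'.2]

theorem lintegral_comp_log_abs {κ : Type*} [Fintype κ] (H : (κ → ℝ) → ENNReal)
    (hH : Measurable H) :
    ∫⁻ s : κ → ℝ, H (fun j => Real.log |s j|) =
      2 ^ Fintype.card κ * ∫⁻ l : κ → ℝ, ENNReal.ofReal (Real.exp (∑ j, l j)) * H l := by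
  classical
  have hm : Measurable fun t : ℝ => Real.log |t| := by fun_prop
  have hm' : Measurable fun s : κ → ℝ => fun j => Real.log |s j| :=
    measurable_pi_lambda _ fun j => hm.comp (measurable_pi_apply j)
  have hd : Measurable fun l : κ → ℝ => ∏ j, ENNReal.ofReal (2 * Real.exp (l j)) := by fun_prop
  have hsf : SigmaFinite (Measure.map (fun t : ℝ => Real.log |t|) volume) := by
    rw [map_log_abs_volume]
    infer_instance
  have key : Measure.map (fun s : κ → ℝ => fun j => Real.log |s j|) volume =
      volume.withDensity fun l => ∏ j, ENNReal.ofReal (2 * Real.exp (l j)) := by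
    rw [volume_pi, Measure.pi_map_pi (f := fun _ t => Real.log |t|) fun _ => hm.aemeasurable]
    refine Measure.pi_eq fun s hs => ?_
    rw [withDensity_apply _ (MeasurableSet.univ_pi hs),
      ← lintegral_indicator (MeasurableSet.univ_pi hs), map_log_abs_volume]
    have hind : (univ.pi s).indicator (fun l : κ → ℝ => ∏ j, ENNReal.ofReal (2 * Real.exp (l j))) =
        fun l => ∏ j, (s j).indicator (fun t => ENNReal.ofReal (2 * Real.exp t)) (l j) := by
      ext l
      by_cases hl : l ∈ univ.pi s
      · rw [indicator_of_mem hl]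
        exact Finset.prod_congr rfl fun j _ => by rw [indicator_of_mem (hl j (mem_univ j))]
      · rw [indicator_of_notMem hl]
        rw [mem_univ_pi] at hl
        push Not at hl
        obtain ⟨j, hj⟩ := hl
        exact (Finset.prod_eq_zero (Finset.mem_univ j) (indicator_of_notMem hj _)).symm
    rw [hind, ← volume_pi, lintegral_prod_apply_eq_prod _ fun j =>
      Measurable.indicator (by fun_prop) (hs j)]
    refine Finset.prod_congr rfl fun j _ => ?_
    rw [lintegral_indicator (hs j), withDensity_apply _ (hs j)]
  rw [← lintegral_map hH hm', key, lintegral_withDensity_eq_lintegral_mul _ hd hH,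
    ← lintegral_const_mul _ (by fun_prop)]
  refine lintegral_congr fun l => ?_
  rw [Pi.mul_apply, ← mul_assoc]
  congr 1
  rw [Real.exp_sum, ENNReal.ofReal_prod_of_nonneg fun _ _ => (Real.exp_pos _).le]
  simp_rw [ENNReal.ofReal_mul zero_le_two]
  rw [Finset.prod_mul_distrib, Finset.prod_const, Finset.card_univ]
  simp

/-- The transition matrix is invertible over `ℤ`, so its determinant is `±1`. This makes `picHaar`
independent of the basis. -/
theorem measurePreserving_constr_apply {V κ κ' : Type*} [AddCommGroup V] [Fintype κ] [Fintype κ']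
    (b : Module.Basis κ ℤ V) (b' : Module.Basis κ' ℤ V) :
    MeasurePreserving (fun (f : κ → ℝ) (j : κ') => b.constr ℝ f (b' j)) := by
  classical
  let e : κ ≃ κ' := b.indexEquiv b'
  let b'' : Module.Basis κ ℤ V := b'.reindex e.symm
  have hunit : IsUnit (b.toMatrix b'').det := by
    refine IsUnit.of_mul_eq_one (b''.toMatrix b).det ?_
    rw [← Matrix.det_mul, Module.Basis.toMatrix_mul_toMatrix_flip, Matrix.det_one]
  let A : Matrix κ κ ℝ := ((b.toMatrix b'').map (Int.castRingHom ℝ)).transpose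
  have hdet : A.det = ((b.toMatrix b'').det : ℝ) := by
    rw [Matrix.det_transpose, ← RingHom.mapMatrix_apply, ← RingHom.map_det]
    rfl
  have habs : |A.det| = 1 := by
    rw [hdet]
    rcases Int.isUnit_iff.1 hunit with h | h <;> simp [h]
  have hA : MeasurePreserving (Matrix.toLin' A) := by
    refine ⟨(LinearMap.continuous_on_pi _).measurable, ?_⟩
    rw [Real.map_matrix_volume_pi_eq_smul_volume_pi (abs_ne_zero.1 (by rw [habs]; exact one_ne_zero)),
      abs_inv, habs]
    simp
  have hcomp := (volume_measurePreserving_piCongrLeft (fun _ : κ' => ℝ) e).comp hA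
  refine (congrArg (fun T => MeasurePreserving T volume volume) ?_).mpr hcomp
  refine funext fun f => funext fun j => ?_
  obtain ⟨i, rfl⟩ := e.surjective j
  rw [Function.comp_apply, MeasurableEquiv.coe_piCongrLeft, Equiv.piCongrLeft_apply_apply]
  simp only [Matrix.toLin'_apply, Matrix.mulVec, dotProduct]
  rw [Module.Basis.constr_apply_fintype]
  refine Finset.sum_congr rfl fun k _ => ?_
  simp [A, b'', Module.Basis.toMatrix_apply]

namespace SmoothProjectiveFan

variable {n : ℕ} {ι : Type*} [Fintype ι] [DecidableEq ι] (F : SmoothProjectiveFan n ι)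

instance finite_maxCone : Finite F.MaxCone :=
  inferInstanceAs (Finite {σ : Finset ι // σ ∈ F.cones ∧ σ.card = n})

/-! ### Maximal cones in `N_ℝ` -/

/-- The `ℝ`-linear extension of a character to `N_ℝ`. -/
noncomputable def evalReal (m : Module.Dual ℤ (Fin n → ℤ)) : (Fin n → ℝ) →ₗ[ℝ] ℝ :=
  Fintype.linearCombination ℝ fun i => (m (Pi.single i 1) : ℝ)

theorem evalReal_apply (m : Module.Dual ℤ (Fin n → ℤ)) (v : Fin n → ℝ) :
    evalReal m v = ∑ i, v i * m (Pi.single i 1) := by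
  simp [evalReal, Fintype.linearCombination_apply]

theorem evalReal_gen (m : Module.Dual ℤ (Fin n → ℤ)) (ρ : ι) :
    evalReal m (fun i => (F.gen ρ i : ℝ)) = m (F.gen ρ) := by
  rw [evalReal_apply]
  conv_rhs => rw [pi_eq_sum_univ' (F.gen ρ)]
  rw [map_sum]
  push_cast
  refine Finset.sum_congr rfl fun i _ => ?_
  have : (Pi.single i 1 : Fin n → ℤ) = fun j => if j = i then 1 else 0 := by
    ext j
    simp [Pi.single_apply]
  rw [map_smul, this, smul_eq_mul]
  push_cast
  rfl

theorem evalReal_sum_gen (m : Module.Dual ℤ (Fin n → ℤ)) (s : Finset ι) (c : ι → ℝ) :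
    evalReal m (∑ ρ ∈ s, c ρ • (fun i => (F.gen ρ i : ℝ))) = ∑ ρ ∈ s, c ρ * m (F.gen ρ) := by
  rw [map_sum]
  refine Finset.sum_congr rfl fun ρ _ => ?_
  rw [map_smul, evalReal_gen, smul_eq_mul]

theorem evalReal_proj (i : Fin n) (v : Fin n → ℝ) :
    evalReal (LinearMap.proj i) v = v i := by
  rw [evalReal_apply]
  simp [Pi.single_apply]

/-- The character which is `1` on `n_ρ` and `0` on the other generators of `σ`; it is `0` for
`ρ ∉ σ`. -/
noncomputable def dualChar (σ : F.MaxCone) (ρ : ι) : Module.Dual ℤ (Fin n → ℤ) :=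
  F.localChar σ (Pi.single ρ 1)

theorem dualChar_gen (σ : F.MaxCone) (ρ : ι) {ρ' : ι} (h : ρ' ∈ σ.1) :
    F.dualChar σ ρ (F.gen ρ') = if ρ' = ρ then 1 else 0 := by
  rw [dualChar, localChar_gen _ _ _ _ h, Pi.single_apply]

theorem dualChar_gen_nonneg (σ : F.MaxCone) (ρ : ι) {ρ' : ι} (h : ρ' ∈ σ.1) :
    0 ≤ F.dualChar σ ρ (F.gen ρ') := by
  rw [dualChar_gen _ _ _ h]
  split_ifs <;> norm_num

theorem localChar_eq_zero (σ : F.MaxCone) {a : ι → ℤ} (h : ∀ ρ ∈ σ.1, a ρ = 0) :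
    F.localChar σ a = 0 := by
  refine (F.coneBasis σ).ext fun ρ => ?_
  rw [coneBasis_apply, localChar_gen _ _ _ _ ρ.2, h _ ρ.2]
  rfl

theorem dualChar_eq_zero (σ : F.MaxCone) {ρ : ι} (h : ρ ∉ σ.1) : F.dualChar σ ρ = 0 :=
  F.localChar_eq_zero σ fun ρ' hρ' => Pi.single_eq_of_ne (fun e : ρ' = ρ => h (e ▸ hρ')) _

theorem sum_smul_dualChar (σ : F.MaxCone) (m : Module.Dual ℤ (Fin n → ℤ)) :
    ∑ ρ ∈ σ.1, m (F.gen ρ) • F.dualChar σ ρ = m := by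
  refine (F.coneBasis σ).ext fun ρ => ?_
  rw [coneBasis_apply, LinearMap.sum_apply, Finset.sum_eq_single ρ.1]
  · simp [dualChar_gen _ _ _ ρ.2]
  · intro ρ' _ hne
    simp [dualChar_gen _ _ _ ρ.2, hne.symm]
  · exact fun h => (h ρ.2).elim

theorem evalReal_sum_smul (s : Finset ι) (a : ι → ℤ) (m : ι → Module.Dual ℤ (Fin n → ℤ))
    (v : Fin n → ℝ) : evalReal (∑ ρ ∈ s, a ρ • m ρ) v = ∑ ρ ∈ s, a ρ * evalReal (m ρ) v := by
  simp only [evalReal_apply, LinearMap.sum_apply, LinearMap.smul_apply, Finset.mul_sum]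
  rw [Finset.sum_comm]
  refine Finset.sum_congr rfl fun i _ => ?_
  push_cast
  rw [Finset.mul_sum]
  refine Finset.sum_congr rfl fun ρ _ => ?_
  simp
  ring

/-- The generators of `σ` form a basis, so the coefficients of `v` are its pairings with the dual
basis, and these characters are nonnegative on `σ`. -/
theorem mem_cone_iff (σ : F.MaxCone) (v : Fin n → ℝ) :
    (∃ c : ι → ℝ, (∀ ρ, 0 ≤ c ρ) ∧ v = ∑ ρ ∈ σ.1, c ρ • (fun i => (F.gen ρ i : ℝ))) ↔
      ∀ m : Module.Dual ℤ (Fin n → ℤ), (∀ ρ ∈ σ.1, 0 ≤ m (F.gen ρ)) → 0 ≤ evalReal m v := by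
  constructor
  · rintro ⟨c, hc, rfl⟩ m hm
    rw [evalReal_sum_gen]
    exact Finset.sum_nonneg fun ρ hρ => mul_nonneg (hc ρ) (by exact_mod_cast hm ρ hρ)
  · intro h
    refine ⟨fun ρ => evalReal (F.dualChar σ ρ) v,
      fun ρ => h _ fun ρ' hρ' => F.dualChar_gen_nonneg σ ρ hρ', ?_⟩
    ext i
    rw [← evalReal_proj i v]
    conv_lhs => rw [← F.sum_smul_dualChar σ (LinearMap.proj i), evalReal_sum_smul]
    rw [Finset.sum_apply]
    refine Finset.sum_congr rfl fun ρ _ => ?_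
    simp [mul_comm]

theorem isClosed_forall_evalReal (σ : F.MaxCone) :
    IsClosed {v : Fin n → ℝ | ∀ m : Module.Dual ℤ (Fin n → ℤ),
      (∀ ρ ∈ σ.1, 0 ≤ m (F.gen ρ)) → 0 ≤ evalReal m v} := by
  simp only [ofPred_forall]
  refine isClosed_iInter fun m => isClosed_iInter fun _ => ?_
  exact isClosed_le continuous_const (LinearMap.continuous_of_finiteDimensional _)

/-- Completeness alone may give a smaller cone. The complement of the union of the maximal cones is
open and is covered by the spans of the lower-dimensional cones, which have measure zero; hence it
is empty. -/
theorem exists_maxCone_evalReal_nonneg (v : Fin n → ℝ) :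
    ∃ σ : F.MaxCone, ∀ m : Module.Dual ℤ (Fin n → ℤ),
      (∀ ρ ∈ σ.1, 0 ≤ m (F.gen ρ)) → 0 ≤ evalReal m v := by
  set K : F.MaxCone → Set (Fin n → ℝ) := fun σ => {v | ∀ m : Module.Dual ℤ (Fin n → ℤ),
    (∀ ρ ∈ σ.1, 0 ≤ m (F.gen ρ)) → 0 ≤ evalReal m v} with hK
  have hclosed : IsClosed (⋃ σ, K σ) := isClosed_iUnion_of_finite F.isClosed_forall_evalReal
  by_contra hcon
  have hv : v ∈ (⋃ σ, K σ)ᶜ := fun h => hcon (mem_iUnion.1 h)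
  have hpos := hclosed.isOpen_compl.measure_pos volume ⟨v, hv⟩
  let g : ι → Fin n → ℝ := fun ρ i => (F.gen ρ i : ℝ)
  let S : {τ : Finset ι // τ.card < n} → Submodule ℝ (Fin n → ℝ) := fun τ =>
    Submodule.span ℝ ((τ.1.image g : Finset (Fin n → ℝ)) : Set (Fin n → ℝ))
  have hS : ∀ τ, volume (S τ : Set (Fin n → ℝ)) = 0 := by
    intro τ
    refine Measure.addHaar_submodule _ _ fun htop => ?_
    have h := finrank_span_finset_le_card (R := ℝ) (τ.1.image g)
    change Module.finrank ℝ (S τ) ≤ _ at h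
    rw [htop, finrank_top, Module.finrank_fin_fun] at h
    exact absurd (h.trans Finset.card_image_le) (not_le.2 τ.2)
  have hsub : (⋃ σ, K σ)ᶜ ⊆ ⋃ τ, (S τ : Set (Fin n → ℝ)) := by
    intro w hw
    obtain ⟨τ, hτ, hc⟩ := F.complete w
    have hle : τ.card ≤ n := by
      obtain ⟨-, e, -⟩ := F.smooth τ hτ
      simpa using Fintype.card_le_of_embedding e
    have hlt : τ.card < n := by
      refine lt_of_le_of_ne hle fun heq => hw (mem_iUnion.2 ⟨⟨τ, hτ, heq⟩, ?_⟩)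
      exact (F.mem_cone_iff ⟨τ, hτ, heq⟩ w).1 hc
    refine mem_iUnion.2 ⟨⟨τ, hlt⟩, ?_⟩
    obtain ⟨c, -, rfl⟩ := hc
    refine Submodule.sum_mem _ fun ρ hρ => Submodule.smul_mem _ _ ?_
    exact Submodule.subset_span (Finset.mem_coe.2 (Finset.mem_image_of_mem g hρ))
  exact hpos.ne' (measure_mono_null hsub (measure_iUnion_null hS))

/-! ### The height in logarithmic coordinates -/

/-- `log |χ^m|` in logarithmic coordinates on the torus. -/
noncomputable def logChar (m : Module.Dual ℤ (Fin n → ℤ)) : (ι → ℝ) →ₗ[ℝ] ℝ :=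
  Fintype.linearCombination ℝ fun ρ => (m (F.gen ρ) : ℝ)

theorem logChar_apply (m : Module.Dual ℤ (Fin n → ℤ)) (x : ι → ℝ) :
    F.logChar m x = ∑ ρ, x ρ * m (F.gen ρ) := by
  simp [logChar, Fintype.linearCombination_apply]

/-- The image of `C_σ` in logarithmic coordinates. -/
def logCone (σ : F.MaxCone) : Set (ι → ℝ) :=
  {x | ∀ m : Module.Dual ℤ (Fin n → ℤ), (∀ ρ ∈ σ.1, 0 ≤ m (F.gen ρ)) → F.logChar m x ≤ 0}

/-- The height over `C_σ` in logarithmic coordinates. -/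
noncomputable def logHeight (σ : F.MaxCone) : (ι → ℝ) →ₗ[ℝ] F.PicDual :=
  Fintype.linearCombination ℝ fun ρ =>
    (Int.castAddHom ℝ).toIntLinearMap ∘ₗ LinearMap.proj ρ ∘ₗ F.reduced σ

theorem chartHeight_eq (σ : F.MaxCone) (y : ι → ℝ) :
    F.chartHeight σ y = F.logHeight σ (fun ρ => Real.log |y ρ|) := rfl

theorem logHeight_apply (σ : F.MaxCone) (x : ι → ℝ) (L : F.Pic) :
    F.logHeight σ x L = ∑ ρ, x ρ * F.reduced σ L ρ := by
  rw [logHeight, Fintype.linearCombination_apply, LinearMap.sum_apply]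
  rfl

theorem logHeight_toPic (σ : F.MaxCone) (x : ι → ℝ) (a : ι → ℤ) :
    F.logHeight σ x (F.toPic a) = ∑ ρ, x ρ * a ρ - F.logChar (F.localChar σ a) x := by
  rw [logHeight_apply, logChar_apply, reduced_toPic, ← Finset.sum_sub_distrib]
  refine Finset.sum_congr rfl fun ρ _ => ?_
  rw [Pi.sub_apply]
  push_cast
  rw [mul_sub]
  rfl

theorem toPic_eq_sum (a : ι → ℤ) : F.toPic a = ∑ ρ, a ρ • F.classD ρ := by
  conv_lhs => rw [← Finset.univ_sum_single a]
  rw [map_sum]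
  refine Finset.sum_congr rfl fun ρ _ => ?_
  rw [classD, ← map_smul, ← Pi.single_smul, smul_eq_mul, mul_one]

theorem sum_apply_classD_mul (v : F.PicDual) (a : ι → ℤ) :
    ∑ ρ, v (F.classD ρ) * a ρ = v (F.toPic a) := by
  rw [toPic_eq_sum, map_sum]
  refine Finset.sum_congr rfl fun ρ _ => ?_
  rw [map_zsmul, zsmul_eq_mul, mul_comm]

theorem logHeight_classD (σ : F.MaxCone) (v : F.PicDual) :
    F.logHeight σ (fun ρ => v (F.classD ρ)) = v := by
  refine LinearMap.ext fun L => ?_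
  rw [logHeight_apply, sum_apply_classD_mul, toPic_reduced]

/-- Principal divisors have class zero: the Néron-Severi torus does not move the values of
characters, so it preserves each `logCone`. -/
theorem logChar_classD (m : Module.Dual ℤ (Fin n → ℤ)) (v : F.PicDual) :
    F.logChar m (fun ρ => v (F.classD ρ)) = 0 := by
  rw [logChar_apply]
  have h := F.sum_apply_classD_mul v (F.divChar m)
  have h0 : F.toPic (F.divChar m) = 0 := (Submodule.Quotient.mk_eq_zero _).2 ⟨m, rfl⟩
  rw [h0, map_zero] at h
  exact h

/-- By this and `mem_cone_iff`, `x` lies in `logCone σ` exactly when `-∑ x ρ • n_ρ` lies in the cone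
`σ`. The sign comes from `|χ^m| ≤ 1` on `C_σ`. -/
theorem logChar_eq_neg_evalReal (m : Module.Dual ℤ (Fin n → ℤ)) (x : ι → ℝ) :
    F.logChar m x = -evalReal m (∑ ρ, -x ρ • (fun i => (F.gen ρ i : ℝ))) := by
  have h := F.evalReal_sum_gen m Finset.univ (fun ρ => -x ρ)
  simp only [neg_smul] at h ⊢
  rw [h, logChar_apply]
  simp

theorem exists_mem_logCone (x : ι → ℝ) : ∃ σ, x ∈ F.logCone σ := by
  obtain ⟨σ, hσ⟩ := F.exists_maxCone_evalReal_nonneg (∑ ρ, -x ρ • (fun i => (F.gen ρ i : ℝ)))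
  refine ⟨σ, fun m hm => ?_⟩
  rw [logChar_eq_neg_evalReal]
  exact neg_nonpos.2 (hσ m hm)

/-- By `F.inter` the corresponding point of `N_ℝ` lies in the common face, on whose generators the
two local characters agree. -/
theorem logHeight_eq_of_mem {σ τ : F.MaxCone} {x : ι → ℝ} (hσ : x ∈ F.logCone σ)
    (hτ : x ∈ F.logCone τ) : F.logHeight σ x = F.logHeight τ x := by
  have hcone : ∀ σ : F.MaxCone, x ∈ F.logCone σ → ∃ c : ι → ℝ, (∀ ρ, 0 ≤ c ρ) ∧
      ∑ ρ, -x ρ • (fun i => (F.gen ρ i : ℝ)) =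
        ∑ ρ ∈ σ.1, c ρ • (fun i => (F.gen ρ i : ℝ)) := by
    intro σ hσ
    refine (F.mem_cone_iff σ _).2 fun m hm => ?_
    have h := hσ m hm
    rw [logChar_eq_neg_evalReal] at h
    exact neg_nonpos.1 h
  obtain ⟨c, -, hc⟩ := F.inter σ.1 σ.2.1 τ.1 τ.2.1 _ (hcone σ hσ) (hcone τ hτ)
  have hchar : ∀ m, F.logChar m x = -∑ ρ ∈ σ.1 ∩ τ.1, c ρ * m (F.gen ρ) := by
    intro m
    rw [logChar_eq_neg_evalReal, hc, evalReal_sum_gen]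
  refine LinearMap.ext fun L => ?_
  obtain ⟨a, rfl⟩ : ∃ a, F.toPic a = L := Submodule.mkQ_surjective _ L
  rw [logHeight_toPic, logHeight_toPic, hchar, hchar]
  congr 2
  refine Finset.sum_congr rfl fun ρ hρ => ?_
  rw [Finset.mem_inter] at hρ
  rw [localChar_gen _ _ _ _ hρ.1, localChar_gen _ _ _ _ hρ.2]

theorem mem_compactPart_iff (σ : F.MaxCone) {y : ι → ℝ} (hy : ∀ ρ, y ρ ≠ 0) :
    y ∈ F.compactPart σ ↔ (fun ρ => Real.log |y ρ|) ∈ F.logCone σ := by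
  have h : ∀ m : Module.Dual ℤ (Fin n → ℤ),
      |∏ ρ, y ρ ^ m (F.gen ρ)| ≤ 1 ↔ F.logChar m (fun ρ => Real.log |y ρ|) ≤ 0 := by
    intro m
    have hprod : |∏ ρ, y ρ ^ m (F.gen ρ)| =
        Real.exp (F.logChar m (fun ρ => Real.log |y ρ|)) := by
      rw [logChar_apply, Real.exp_sum, Finset.abs_prod]
      refine Finset.prod_congr rfl fun ρ _ => ?_
      rw [abs_zpow, Real.exp_mul, Real.exp_log (abs_pos.2 (hy ρ)), Real.rpow_intCast]
    rw [hprod, Real.exp_le_one_iff]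
  simp only [compactPart, logCone, mem_ofPred_eq, h]
  exact ⟨fun h => h.2, fun h => ⟨fun ρ _ => hy ρ, h⟩⟩

theorem torsorHeight_eq {σ : F.MaxCone} {y : ι → ℝ} (hy : ∀ ρ, y ρ ≠ 0)
    (h : (fun ρ => Real.log |y ρ|) ∈ F.logCone σ) :
    F.torsorHeight y = F.logHeight σ (fun ρ => Real.log |y ρ|) := by
  have hex : ∃ σ, y ∈ F.compactPart σ := ⟨σ, (F.mem_compactPart_iff σ hy).2 h⟩
  rw [torsorHeight, dif_pos hex, chartHeight_eq]
  exact F.logHeight_eq_of_mem ((F.mem_compactPart_iff _ hy).1 hex.choose_spec) h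

/-- The torsor height is equivariant under the Néron-Severi torus. -/
theorem torsorHeight_eq_add {y w : ι → ℝ} (hy : ∀ ρ, y ρ ≠ 0) (hw : ∀ ρ, w ρ ≠ 0) (v : F.PicDual)
    (h : ∀ ρ, Real.log |w ρ| = Real.log |y ρ| + v (F.classD ρ)) :
    F.torsorHeight w = F.torsorHeight y + v := by
  obtain ⟨σ, hσ⟩ := F.exists_mem_logCone (fun ρ => Real.log |y ρ|)
  have hfun : (fun ρ => Real.log |w ρ|) = (fun ρ => Real.log |y ρ|) + fun ρ => v (F.classD ρ) :=
    funext h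
  have hσ' : (fun ρ => Real.log |w ρ|) ∈ F.logCone σ := by
    intro m hm
    rw [hfun, map_add, logChar_classD, add_zero]
    exact hσ m hm
  rw [F.torsorHeight_eq hw hσ', F.torsorHeight_eq hy hσ, hfun, map_add, logHeight_classD]

/-- The difference of the two sides is `-log |χ^m|` for `m = dualChar σ ρ`, which is nonnegative on
`σ`. -/
theorem le_logHeight_classD {σ : F.MaxCone} {x : ι → ℝ} (hx : x ∈ F.logCone σ) (ρ : ι) :
    x ρ ≤ F.logHeight σ x (F.classD ρ) := by
  rw [classD, logHeight_toPic]
  have h1 : ∑ ρ', x ρ' * ((Pi.single ρ 1 : ι → ℤ) ρ' : ℝ) = x ρ := by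
    simp [Pi.single_apply]
  have h2 := hx (F.dualChar σ ρ) fun ρ' hρ' => F.dualChar_gen_nonneg σ ρ hρ'
  rw [dualChar] at h2
  rw [h1]
  linarith

/-! ### A basis of the Picard group -/

/-- The classes of the divisors `D_ρ`, `ρ ∉ σ`, form a basis of the Picard group. -/
noncomputable def picEquiv (σ : F.MaxCone) : F.Pic ≃ₗ[ℤ] ({ρ : ι // ρ ∉ σ.1} → ℤ) where
  toFun L ρ := F.reduced σ L ρ
  map_add' L L' := by
    ext
    simp
  map_smul' c L := by
    ext
    simp
  invFun f := F.toPic fun ρ => if h : ρ ∈ σ.1 then 0 else f ⟨ρ, h⟩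
  left_inv L := by
    conv_rhs => rw [← F.toPic_reduced σ L]
    refine congrArg F.toPic (funext fun ρ => ?_)
    split_ifs with h
    · obtain ⟨a, rfl⟩ : ∃ a, F.toPic a = L := Submodule.mkQ_surjective _ L
      rw [reduced_toPic, Pi.sub_apply, eq_comm, sub_eq_zero]
      exact (F.localChar_gen σ a ρ h).symm
    · rfl
  right_inv f := by
    refine funext fun ρ => ?_
    change F.reduced σ (F.toPic _) ρ.1 = f ρ
    rw [reduced_toPic, F.localChar_eq_zero σ fun ρ' hρ' => by simp [hρ']]
    simp [ρ.2]

noncomputable def picBasis (σ : F.MaxCone) : Module.Basis {ρ : ι // ρ ∉ σ.1} ℤ F.Pic :=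
  Module.Basis.ofEquivFun (F.picEquiv σ)

theorem picBasis_apply (σ : F.MaxCone) (ρ : {ρ : ι // ρ ∉ σ.1}) :
    F.picBasis σ ρ = F.classD ρ := by
  rw [picBasis, Module.Basis.coe_ofEquivFun, classD]
  refine congrArg F.toPic (funext fun ρ' => ?_)
  by_cases h : ρ' ∈ σ.1
  · have : ρ' ≠ ρ := fun e => ρ.2 (e ▸ h)
    simp [h, this]
  · rcases eq_or_ne ρ' ρ with rfl | hne
    · simp [h]
    · have : (⟨ρ', h⟩ : {ρ : ι // ρ ∉ σ.1}) ≠ ρ := fun e => hne (congrArg Subtype.val e)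
      simp [h, hne, this]

theorem card_compl_eq_picRank (σ : F.MaxCone) :
    Fintype.card {ρ : ι // ρ ∉ σ.1} = F.picRank :=
  (Module.finrank_eq_card_basis (F.picBasis σ)).symm

/-! ### Topology and measure on the dual of the Picard group -/

instance picDualBorelSpace : BorelSpace F.PicDual := ⟨rfl⟩

theorem continuous_picDual_apply (L : F.Pic) : Continuous fun v : F.PicDual => v L :=
  (continuous_apply L).comp (continuous_induced_dom (f := fun (v : F.PicDual) L => v L))

theorem continuous_picDual_iff {X : Type*} [TopologicalSpace X] {f : X → F.PicDual} :
    Continuous f ↔ ∀ L, Continuous fun x => f x L := by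
  rw [continuous_induced_rng, continuous_pi_iff]
  rfl

/-- The coordinates on the dual of the Picard group given by a basis, as a homeomorphism. -/
noncomputable def constrHomeomorph {κ : Type*} [Fintype κ] (b : Module.Basis κ ℤ F.Pic) :
    (κ → ℝ) ≃ₜ F.PicDual where
  toEquiv := (b.constr ℝ).toEquiv
  continuous_toFun := by
    refine F.continuous_picDual_iff.2 fun L => ?_
    change Continuous fun f => b.constr ℝ f L
    simp only [Module.Basis.constr_apply_fintype]
    fun_prop
  continuous_invFun := continuous_pi fun i => F.continuous_picDual_apply (b i)

instance picDualT2Space : T2Space F.PicDual :=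
  (F.constrHomeomorph (Module.Free.chooseBasis ℤ F.Pic)).symm.isEmbedding.t2Space

theorem picHaar_eq_map {κ : Type*} [Fintype κ] (b : Module.Basis κ ℤ F.Pic) :
    F.picHaar = Measure.map (b.constr ℝ) volume := by
  let b₀ := Module.Free.chooseBasis ℤ F.Pic
  have hm : Measurable (b.constr ℝ : (κ → ℝ) → F.PicDual) :=
    (F.constrHomeomorph b).continuous.measurable
  have hp := measurePreserving_constr_apply b₀ b
  have hcomp : (b₀.constr ℝ : _ → F.PicDual) =
      (b.constr ℝ : (κ → ℝ) → F.PicDual) ∘ fun f j => b₀.constr ℝ f (b j) := by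
    refine funext fun f => (b.ext fun j => ?_)
    rw [Function.comp_apply, Module.Basis.constr_basis]
  rw [picHaar]
  conv_rhs => rw [← hp.map_eq, Measure.map_map hm hp.measurable]
  rw [← hcomp]

end SmoothProjectiveFan

/-! ### Splitting and rescaling the variables of an integral. -/

theorem lintegral_eq_lintegral_lintegral_dite {ι : Type*} [Fintype ι] (p : ι → Prop)
    [DecidablePred p] [i₁ : Fintype {i // p i}] [i₂ : Fintype {i // ¬p i}]
    {f : (ι → ℝ) → ENNReal} (hf : Measurable f) :
    ∫⁻ y, f y = ∫⁻ s : {i // ¬p i} → ℝ, ∫⁻ w : {i // p i} → ℝ,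
      f (fun i => if h : p i then w ⟨i, h⟩ else s ⟨i, h⟩) := by
  obtain rfl : i₁ = Subtype.fintype p := Subsingleton.elim _ _
  obtain rfl : i₂ = Subtype.fintype fun i => ¬p i := Subsingleton.elim _ _
  have h := (volume_preserving_piEquivPiSubtypeProd (fun _ : ι => ℝ) p).symm
  rw [← h.lintegral_comp hf, Measure.volume_eq_prod, lintegral_prod_symm']
  · rfl
  · exact hf.comp (MeasurableEquiv.measurable _)

theorem lintegral_eq_mul_lintegral_mul {κ : Type*} [Fintype κ] {a : κ → ℝ} (ha : ∀ i, a i ≠ 0)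
    {f : (κ → ℝ) → ENNReal} (hf : Measurable f) :
    ∫⁻ w, f w = ENNReal.ofReal (∏ i, |a i|) * ∫⁻ x : κ → ℝ, f (fun i => a i * x i) := by
  classical
  have hdet : (Matrix.diagonal a).det ≠ 0 := by
    rw [Matrix.det_diagonal]
    exact Finset.prod_ne_zero_iff.2 fun i _ => ha i
  have hm : Measurable (Matrix.toLin' (Matrix.diagonal a)) :=
    (LinearMap.continuous_on_pi _).measurable
  conv_lhs => rw [← Real.smul_map_diagonal_volume_pi hdet]
  rw [lintegral_smul_measure, lintegral_map hf hm, Matrix.det_diagonal, Finset.abs_prod,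
    smul_eq_mul]
  congr 2
  ext x
  congr 1
  ext i
  simp [Matrix.toLin'_apply, Matrix.mulVec_diagonal]

namespace SmoothProjectiveFan

variable {n : ℕ} {ι : Type*} [Fintype ι] [DecidableEq ι] (F : SmoothProjectiveFan n ι)

/-! ### Measurability of the height on the torus -/

theorem isClosed_logCone (σ : F.MaxCone) : IsClosed (F.logCone σ) := by
  simp only [logCone, ofPred_forall]
  refine isClosed_iInter fun m => isClosed_iInter fun _ => ?_
  exact isClosed_le (LinearMap.continuous_of_finiteDimensional _) continuous_const

theorem continuous_logHeight (σ : F.MaxCone) : Continuous (F.logHeight σ) := by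
  refine F.continuous_picDual_iff.2 fun L => ?_
  simp only [logHeight_apply]
  fun_prop

/-- The height on the torus as a function of logarithmic coordinates. -/
noncomputable def logTorsorHeight (x : ι → ℝ) : F.PicDual :=
  F.logHeight (F.exists_mem_logCone x).choose x

theorem logTorsorHeight_eq {σ : F.MaxCone} {x : ι → ℝ} (hx : x ∈ F.logCone σ) :
    F.logTorsorHeight x = F.logHeight σ x :=
  F.logHeight_eq_of_mem (F.exists_mem_logCone x).choose_spec hx

theorem torsorHeight_eq_logTorsorHeight {y : ι → ℝ} (hy : ∀ ρ, y ρ ≠ 0) :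
    F.torsorHeight y = F.logTorsorHeight (fun ρ => Real.log |y ρ|) :=
  F.torsorHeight_eq hy (F.exists_mem_logCone _).choose_spec

theorem measurable_logTorsorHeight : Measurable F.logTorsorHeight := by
  intro D hD
  have : F.logTorsorHeight ⁻¹' D = ⋃ σ, F.logCone σ ∩ F.logHeight σ ⁻¹' D := by
    ext x
    simp only [mem_preimage, mem_iUnion, mem_inter_iff]
    constructor
    · intro h
      exact ⟨_, (F.exists_mem_logCone x).choose_spec, h⟩
    · rintro ⟨σ, hσ, h⟩
      rwa [F.logTorsorHeight_eq hσ]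
  rw [this]
  exact MeasurableSet.iUnion fun σ =>
    (F.isClosed_logCone σ).measurableSet.inter ((F.continuous_logHeight σ).measurable hD)

theorem measurable_log_abs :
    Measurable fun (y : ι → ℝ) ρ => Real.log |y ρ| := by fun_prop

/-! ### Coordinates of a point of the torus in the chart of a maximal cone -/

/-- The element of the Néron-Severi torus with given coordinates outside `σ` acts on the coordinate
`ρ` through this factor. -/
noncomputable def nsFactor (σ : F.MaxCone) (s : {ρ : ι // ρ ∉ σ.1} → ℝ) (ρ : ι) : ℝ :=
  ∏ ρ', s ρ' ^ F.reduced σ (F.classD ρ) ρ'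

theorem reduced_classD_of_notMem (σ : F.MaxCone) {ρ : ι} (h : ρ ∉ σ.1) :
    F.reduced σ (F.classD ρ) = Pi.single ρ 1 := by
  have h0 : F.localChar σ (Pi.single ρ 1) = 0 := F.dualChar_eq_zero σ h
  rw [classD, reduced_toPic, h0, map_zero, sub_zero]

theorem nsFactor_of_notMem (σ : F.MaxCone) (s : {ρ : ι // ρ ∉ σ.1} → ℝ) {ρ : ι} (h : ρ ∉ σ.1) :
    F.nsFactor σ s ρ = s ⟨ρ, h⟩ := by
  rw [nsFactor, F.reduced_classD_of_notMem σ h, Finset.prod_eq_single ⟨ρ, h⟩]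
  · simp
  · intro ρ' _ hne
    have : ρ'.1 ≠ ρ := fun e => hne (Subtype.ext e)
    simp [this]
  · simp

theorem nsFactor_ne_zero (σ : F.MaxCone) {s : {ρ : ι // ρ ∉ σ.1} → ℝ} (hs : ∀ ρ, s ρ ≠ 0)
    (ρ : ι) : F.nsFactor σ s ρ ≠ 0 :=
  Finset.prod_ne_zero_iff.2 fun ρ' _ => zpow_ne_zero _ (hs ρ')

theorem log_abs_nsFactor (σ : F.MaxCone) {s : {ρ : ι // ρ ∉ σ.1} → ℝ} (hs : ∀ ρ, s ρ ≠ 0)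
    (ρ : ι) : Real.log |F.nsFactor σ s ρ| =
      (F.picBasis σ).constr ℝ (fun ρ => Real.log |s ρ|) (F.classD ρ) := by
  rw [nsFactor, Finset.abs_prod, Real.log_prod fun ρ' _ => abs_ne_zero.2 (zpow_ne_zero _ (hs ρ')),
    Module.Basis.constr_apply_fintype]
  refine Finset.sum_congr rfl fun ρ' _ => ?_
  rw [abs_zpow, Real.log_zpow, zsmul_eq_mul, picBasis, Module.Basis.equivFun_ofEquivFun]
  rfl

theorem exists_hom_eq_nsFactor (σ : F.MaxCone) {s : {ρ : ι // ρ ∉ σ.1} → ℝ} (hs : ∀ ρ, s ρ ≠ 0) :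
    ∃ g : Multiplicative F.Pic →* ℝˣ,
      ∀ ρ, (g (Multiplicative.ofAdd (F.classD ρ)) : ℝ) = F.nsFactor σ s ρ := by
  refine ⟨{ toFun := fun L => ∏ ρ', Units.mk0 (s ρ') (hs ρ') ^ F.reduced σ L.toAdd ρ'
            map_one' := by simp
            map_mul' := fun L L' => by simp [zpow_add, Finset.prod_mul_distrib] }, fun ρ => ?_⟩
  simp [nsFactor]

/-- The coordinates in the chart of `σ` of the image in `X(ℝ)` of a point of the torus. -/
noncomputable def chartCoord (σ : F.MaxCone) (y : ι → ℝ) (ρ : σ.1) : ℝ :=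
  y ρ / F.nsFactor σ (fun ρ => y ρ) ρ

theorem measurable_chartCoord (σ : F.MaxCone) : Measurable (F.chartCoord σ) := by
  refine measurable_pi_lambda _ fun ρ => ?_
  unfold chartCoord nsFactor
  fun_prop

theorem mem_torsor {y : ι → ℝ} (hy : ∀ ρ, y ρ ≠ 0) : y ∈ F.torsor := by
  obtain ⟨σ⟩ := F.nonempty_maxCone
  exact ⟨σ.1, σ.2.1, fun ρ _ => hy ρ⟩

theorem chart_chartCoord (σ : F.MaxCone) {y : ι → ℝ} (hy : ∀ ρ, y ρ ≠ 0) :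
    F.chart σ (F.chartCoord σ y) = Quotient.mk F.torsorSetoid ⟨y, F.mem_torsor hy⟩ := by
  obtain ⟨g, hg⟩ := F.exists_hom_eq_nsFactor σ (s := fun ρ => y ρ) fun ρ => hy ρ
  refine Quotient.sound ⟨g, fun ρ => ?_⟩
  rw [hg]
  by_cases h : ρ ∈ σ.1
  · have := F.nsFactor_ne_zero σ (s := fun ρ => y ρ) (fun ρ => hy ρ) ρ
    simp only [chartLift, h, dif_pos, chartCoord]
    field_simp
  · simp [chartLift, h, nsFactor_of_notMem]

/-- The points of the torus whose image in `X(ℝ)` lies in `E` and whose height lies in `D`. -/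
def torusSet (σ : F.MaxCone) (E : Set F.RealPoints) (D : Set F.PicDual) : Set (ι → ℝ) :=
  {y | (∀ ρ, y ρ ≠ 0) ∧ F.chart σ (F.chartCoord σ y) ∈ E ∧
    F.logTorsorHeight (fun ρ => Real.log |y ρ|) ∈ D}

/-- The chart enters only through the class of `y` in `X(ℝ)`. The agreement of the chart measures
rests on this. -/
theorem torusSet_eq (σ τ : F.MaxCone) (E : Set F.RealPoints) (D : Set F.PicDual) :
    F.torusSet σ E D = F.torusSet τ E D := by
  ext y
  refine and_congr_right fun hy => ?_
  rw [F.chart_chartCoord σ hy, F.chart_chartCoord τ hy]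

instance realPointsBorelSpace : BorelSpace F.RealPoints := ⟨rfl⟩

theorem measurable_chart (σ : F.MaxCone) : Measurable (F.chart σ) := by
  refine Continuous.measurable (continuous_quotient_mk'.comp ?_)
  refine Continuous.subtype_mk (continuous_pi fun ρ => ?_) _
  split_ifs
  · exact continuous_apply _
  · exact continuous_const

theorem measurableSet_forall_ne_zero {κ : Type*} [Countable κ] :
    MeasurableSet {y : κ → ℝ | ∀ i, y i ≠ 0} := by
  simp only [ofPred_forall]
  exact MeasurableSet.iInter fun i => (measurable_pi_apply i) (measurableSet_singleton 0).compl

theorem ae_forall_ne_zero {κ : Type*} [Fintype κ] : ∀ᵐ y : κ → ℝ, ∀ i, y i ≠ 0 := by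
  refine ae_all_iff.2 fun i => ?_
  have h : ∀ᵐ t : ℝ, t ≠ 0 := by simp [ae_iff]
  exact (Measure.tendsto_eval_ae_ae (μ := fun _ : κ => (volume : Measure ℝ)) (i := i)).eventually h

theorem measurableSet_torusSet (σ : F.MaxCone) {E : Set F.RealPoints} (hE : MeasurableSet E)
    {D : Set F.PicDual} (hD : MeasurableSet D) : MeasurableSet (F.torusSet σ E D) :=
  measurableSet_forall_ne_zero.inter
    (((F.measurable_chart σ).comp (F.measurable_chartCoord σ) hE).inter
      ((F.measurable_logTorsorHeight.comp measurable_log_abs) hD))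

/-! ### The volume of a set of points of the torus of bounded height -/

/-- The measure given by the chart of `σ`. -/
noncomputable def chartMeasure (σ : F.MaxCone) : Measure F.RealPoints :=
  Measure.map (F.chart σ) ((volume : Measure (σ.1 → ℝ)).withDensity fun x =>
    ENNReal.ofReal (Real.exp (-(F.torsorHeight (F.chartLift σ x).1 F.antican))))

theorem nu_apply (σ : F.MaxCone) {D : Set F.PicDual} (hD : MeasurableSet D) :
    F.nu D = ∫⁻ l, ENNReal.ofReal (Real.exp ((F.picBasis σ).constr ℝ l F.antican)) *
      D.indicator 1 ((F.picBasis σ).constr ℝ l) := by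
  have hm : Measurable ((F.picBasis σ).constr ℝ : _ → F.PicDual) :=
    (F.constrHomeomorph (F.picBasis σ)).continuous.measurable
  have hev : Measurable fun v : F.PicDual => ENNReal.ofReal (Real.exp (v F.antican)) :=
    ((F.continuous_picDual_apply F.antican).rexp).measurable.ennreal_ofReal
  rw [nu, withDensity_apply _ hD, ← lintegral_indicator hD, F.picHaar_eq_map (F.picBasis σ),
    lintegral_map (hev.indicator hD) hm]
  refine lintegral_congr fun l => ?_
  by_cases h : (F.picBasis σ).constr ℝ l ∈ D <;> simp [h]

/-- With `c` the height of a chart point, the exponential factor is the norm of the local generator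
of `ω_X⁻¹`. -/
theorem lintegral_translate (σ : F.MaxCone) {D : Set F.PicDual} (hD : MeasurableSet D)
    (c : {ρ : ι // ρ ∉ σ.1} → ℝ) :
    ∫⁻ l, ENNReal.ofReal (Real.exp ((F.picBasis σ).constr ℝ l F.antican)) *
        D.indicator 1 ((F.picBasis σ).constr ℝ (c + l)) =
      ENNReal.ofReal (Real.exp (-((F.picBasis σ).constr ℝ c F.antican))) * F.nu D := by
  have hm : Measurable ((F.picBasis σ).constr ℝ : _ → F.PicDual) :=
    (F.constrHomeomorph (F.picBasis σ)).continuous.measurable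
  have hev : Measurable fun v : F.PicDual => ENNReal.ofReal (Real.exp (v F.antican)) :=
    ((F.continuous_picDual_apply F.antican).rexp).measurable.ennreal_ofReal
  have hint : Measurable fun l => ENNReal.ofReal (Real.exp ((F.picBasis σ).constr ℝ l F.antican)) *
      D.indicator 1 ((F.picBasis σ).constr ℝ l) :=
    (hev.comp hm).mul ((measurable_one.indicator hD).comp hm)
  rw [F.nu_apply σ hD, ← lintegral_const_mul _ hint,
    ← lintegral_add_left_eq_self (fun l => ENNReal.ofReal _ * (ENNReal.ofReal _ * _)) c]
  refine lintegral_congr fun l => ?_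
  rw [← mul_assoc, ← ENNReal.ofReal_mul (Real.exp_pos _).le, ← Real.exp_add, map_add,
    LinearMap.add_apply, neg_add_cancel_left]

theorem chartLift_apply_of_mem (σ : F.MaxCone) (x : σ.1 → ℝ) {ρ : ι} (h : ρ ∈ σ.1) :
    (F.chartLift σ x).1 ρ = x ⟨ρ, h⟩ := by
  simp [chartLift, h]

theorem chartLift_apply_of_notMem (σ : F.MaxCone) (x : σ.1 → ℝ) {ρ : ι} (h : ρ ∉ σ.1) :
    (F.chartLift σ x).1 ρ = 1 := by
  simp [chartLift, h]

theorem chartLift_ne_zero (σ : F.MaxCone) {x : σ.1 → ℝ} (hx : ∀ ρ, x ρ ≠ 0) (ρ : ι) :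
    (F.chartLift σ x).1 ρ ≠ 0 := by
  by_cases h : ρ ∈ σ.1
  · rw [chartLift_apply_of_mem _ _ _ h]
    exact hx _
  · rw [chartLift_apply_of_notMem _ _ _ h]
    exact one_ne_zero

theorem mem_torusSet_iff (σ : F.MaxCone) (E : Set F.RealPoints) (D : Set F.PicDual)
    {s : {ρ : ι // ρ ∉ σ.1} → ℝ} (hs : ∀ ρ, s ρ ≠ 0) (x : σ.1 → ℝ) {y : ι → ℝ}
    (hy : ∀ ρ, y ρ = F.nsFactor σ s ρ * (F.chartLift σ x).1 ρ) :
    y ∈ F.torusSet σ E D ↔ (∀ ρ, x ρ ≠ 0) ∧ F.chart σ x ∈ E ∧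
      F.logTorsorHeight (fun ρ => Real.log |(F.chartLift σ x).1 ρ|) +
        (F.picBasis σ).constr ℝ (fun ρ => Real.log |s ρ|) ∈ D := by
  have hne := F.nsFactor_ne_zero σ hs
  have hys : (fun ρ : {ρ : ι // ρ ∉ σ.1} => y ρ) = s := by
    refine funext fun ρ => ?_
    rw [hy, nsFactor_of_notMem _ _ _ ρ.2, chartLift_apply_of_notMem _ _ _ ρ.2, mul_one]
  have hcoord : F.chartCoord σ y = x := by
    refine funext fun ρ => ?_
    rw [chartCoord, hys, hy, chartLift_apply_of_mem _ _ _ ρ.2, mul_div_cancel_left₀ _ (hne ρ)]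
  have hy0 : (∀ ρ, y ρ ≠ 0) ↔ ∀ ρ, x ρ ≠ 0 := by
    constructor
    · intro h ρ hρ
      refine h ρ ?_
      rw [hy, chartLift_apply_of_mem _ _ _ ρ.2, hρ, mul_zero]
    · intro h ρ
      rw [hy]
      exact mul_ne_zero (hne ρ) (F.chartLift_ne_zero σ h ρ)
  rw [torusSet, mem_ofPred_eq, hcoord, hy0]
  refine and_congr_right fun hx => and_congr_right fun _ => ?_
  rw [← F.torsorHeight_eq_logTorsorHeight (hy0.2 hx),
    ← F.torsorHeight_eq_logTorsorHeight (F.chartLift_ne_zero σ hx),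
    F.torsorHeight_eq_add (F.chartLift_ne_zero σ hx) (hy0.2 hx)
      ((F.picBasis σ).constr ℝ (fun ρ => Real.log |s ρ|))]
  intro ρ
  rw [hy, abs_mul, Real.log_mul (abs_ne_zero.2 (hne ρ))
    (abs_ne_zero.2 (F.chartLift_ne_zero σ hx ρ)), log_abs_nsFactor _ _ hs, add_comm]

/-- The first sum is the log-Jacobian of `s ↦ log |s|` inverted, the second that of scaling the
coordinates in `σ` by `nsFactor`. Together they give the density of `ν`. -/
theorem constr_apply_antican (σ : F.MaxCone) (l : {ρ : ι // ρ ∉ σ.1} → ℝ) :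
    (F.picBasis σ).constr ℝ l F.antican =
      ∑ ρ, l ρ + ∑ ρ : σ.1, (F.picBasis σ).constr ℝ l (F.classD ρ) := by
  have h : ∀ ρ : {ρ : ι // ρ ∉ σ.1}, (F.picBasis σ).constr ℝ l (F.classD ρ) = l ρ := by
    intro ρ
    rw [← F.picBasis_apply σ ρ, Module.Basis.constr_basis]
  rw [antican, map_sum, ← Fintype.sum_subtype_add_sum_subtype (fun ρ => ρ ∈ σ.1), add_comm]
  simp only [h]
  congr!

/-- Write `y` as `nsFactor σ s` times the lift of a chart point `x`. The image in `X(ℝ)` depends on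
`x` alone, and the height is a function of `x` plus a linear form in `log |s|`. For fixed `x` the
integral over `s` is `2 ^ t` times `ν` of a translate of `D`; the integral over `x` that remains is
the chart measure. -/
theorem volume_torusSet (σ : F.MaxCone) {E : Set F.RealPoints} (hE : MeasurableSet E)
    {D : Set F.PicDual} (hD : MeasurableSet D) :
    volume (F.torusSet σ E D) = 2 ^ F.picRank * F.nu D * F.chartMeasure σ E := by
  let L := (F.picBasis σ).constr (M' := ℝ) ℝ
  have hL : Measurable (L : _ → F.PicDual) :=
    (F.constrHomeomorph (F.picBasis σ)).continuous.measurable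
  let c : (σ.1 → ℝ) → {ρ : ι // ρ ∉ σ.1} → ℝ := fun x ρ =>
    F.logTorsorHeight (fun ρ => Real.log |(F.chartLift σ x).1 ρ|) (F.classD ρ)
  have hlift : Measurable fun x => (F.chartLift σ x).1 := by
    refine measurable_pi_lambda _ fun ρ => ?_
    by_cases h : ρ ∈ σ.1
    · simp only [chartLift_apply_of_mem _ _ _ h]
      exact measurable_pi_apply _
    · simp only [chartLift_apply_of_notMem _ _ _ h]
      exact measurable_const
  have hc : Measurable c := measurable_pi_lambda _ fun ρ =>
    (F.continuous_picDual_apply _).measurable.comp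
      (F.measurable_logTorsorHeight.comp (measurable_log_abs.comp hlift))
  have hLc : ∀ x, L (c x) = F.logTorsorHeight (fun ρ => Real.log |(F.chartLift σ x).1 ρ|) := by
    intro x
    refine (F.picBasis σ).ext fun ρ => ?_
    rw [Module.Basis.constr_basis, picBasis_apply]
  let X : Set (σ.1 → ℝ) := {x | ∀ ρ, x ρ ≠ 0} ∩ F.chart σ ⁻¹' E
  have hX : MeasurableSet X := measurableSet_forall_ne_zero.inter (F.measurable_chart σ hE)
  let φ : ({ρ : ι // ρ ∉ σ.1} → ℝ) → ENNReal := fun l =>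
    ENNReal.ofReal (Real.exp (∑ ρ : σ.1, L l (F.classD ρ)))
  have hφ : Measurable φ := by
    refine Measurable.ennreal_ofReal (Real.measurable_exp.comp ?_)
    exact Finset.measurable_fun_sum _ fun ρ _ =>
      (F.continuous_picDual_apply _).measurable.comp hL
  let ψ : (σ.1 → ℝ) × ({ρ : ι // ρ ∉ σ.1} → ℝ) → ENNReal := fun z =>
    X.indicator 1 z.1 * D.indicator 1 (L (c z.1 + z.2))
  have hψ : Measurable ψ := by
    refine ((measurable_one.indicator hX).comp measurable_fst).mul
      ((measurable_one.indicator hD).comp (hL.comp ?_))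
    exact (hc.comp measurable_fst).add measurable_snd
  have hA := F.measurableSet_torusSet σ hE hD
  have hlog : Measurable fun (s : {ρ : ι // ρ ∉ σ.1} → ℝ) ρ => Real.log |s ρ| := by fun_prop
  have inner : ∀ s : {ρ : ι // ρ ∉ σ.1} → ℝ, (∀ ρ, s ρ ≠ 0) →
      ∫⁻ w : σ.1 → ℝ, (F.torusSet σ E D).indicator 1
        (fun i => if h : i ∈ σ.1 then w ⟨i, h⟩ else s ⟨i, h⟩) =
      ∫⁻ x, φ (fun ρ => Real.log |s ρ|) * ψ (x, fun ρ => Real.log |s ρ|) := by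
    intro s hs
    have hne := F.nsFactor_ne_zero σ hs
    have hglue : Measurable fun w : σ.1 → ℝ =>
        (fun i => if h : i ∈ σ.1 then w ⟨i, h⟩ else s ⟨i, h⟩ : ι → ℝ) := by
      refine measurable_pi_lambda _ fun i => ?_
      split_ifs
      · exact measurable_pi_apply _
      · exact measurable_const
    have hfm : Measurable fun w : σ.1 → ℝ => (F.torusSet σ E D).indicator (1 : (ι → ℝ) → ENNReal)
        (fun i => if h : i ∈ σ.1 then w ⟨i, h⟩ else s ⟨i, h⟩) :=
      (measurable_one.indicator hA).comp hglue
    have hψs : Measurable fun x => ψ (x, fun ρ => Real.log |s ρ|) :=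
      hψ.comp measurable_prodMk_right
    rw [lintegral_eq_mul_lintegral_mul (a := fun ρ : σ.1 => F.nsFactor σ s ρ) (fun ρ => hne ρ)
      hfm, lintegral_const_mul _ hψs]
    congr 1
    · simp only [φ]
      congr 1
      rw [Real.exp_sum]
      refine Finset.prod_congr rfl fun ρ _ => ?_
      rw [← F.log_abs_nsFactor σ hs, Real.exp_log (abs_pos.2 (hne ρ))]
    · refine lintegral_congr fun x => ?_
      have hiff := F.mem_torusSet_iff σ E D hs x
        (y := fun i => if h : i ∈ σ.1 then F.nsFactor σ s i * x ⟨i, h⟩ else s ⟨i, h⟩) ?_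
      · rw [← hLc, ← map_add, ← and_assoc] at hiff
        simp only [ψ]
        by_cases h1 : x ∈ X
        · by_cases h2 : L (c x + fun ρ => Real.log |s ρ|) ∈ D
          · rw [indicator_of_mem (hiff.2 ⟨h1, h2⟩), indicator_of_mem h1,
              indicator_of_mem h2]
            simp
          · rw [indicator_of_notMem fun h => h2 (hiff.1 h).2,
              indicator_of_notMem h2, mul_zero]
        · rw [indicator_of_notMem fun h => h1 (hiff.1 h).1,
            indicator_of_notMem h1, zero_mul]
      · intro ρ
        by_cases h : ρ ∈ σ.1
        · simp only [h, dif_pos, chartLift_apply_of_mem]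
        · simp only [h, dif_neg, not_false_eq_true, chartLift_apply_of_notMem,
            nsFactor_of_notMem, mul_one]
  have hL' : ∀ x, ∫⁻ s : {ρ : ι // ρ ∉ σ.1} → ℝ, φ (fun ρ => Real.log |s ρ|) * ψ (x, fun ρ => Real.log |s ρ|) =
      2 ^ F.picRank * F.nu D *
        X.indicator (fun x => ENNReal.ofReal (Real.exp (-(L (c x) F.antican)))) x := by
    intro x
    rw [lintegral_comp_log_abs (fun l => φ l * ψ (x, l))
      (hφ.mul (hψ.comp measurable_prodMk_left)), F.card_compl_eq_picRank, mul_assoc]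
    congr 1
    have hval : ∀ l, ENNReal.ofReal (Real.exp (∑ j, l j)) * (φ l * ψ (x, l)) =
        X.indicator 1 x * (ENNReal.ofReal (Real.exp (L l F.antican)) *
          D.indicator 1 (L (c x + l))) := by
      intro l
      simp only [φ, ψ]
      rw [F.constr_apply_antican σ l, Real.exp_add, ENNReal.ofReal_mul (Real.exp_pos _).le]
      ring
    simp_rw [hval]
    by_cases hx : x ∈ X
    · simp only [indicator_of_mem hx, Pi.one_apply, one_mul]
      rw [F.lintegral_translate σ hD (c x), mul_comm]
    · simp [indicator_of_notMem hx]
  have hswap : Measurable (Function.uncurry fun (s : {ρ : ι // ρ ∉ σ.1} → ℝ) (x : σ.1 → ℝ) =>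
      φ (fun ρ => Real.log |s ρ|) * ψ (x, fun ρ => Real.log |s ρ|)) := by
    refine (hφ.comp (hlog.comp measurable_fst)).mul (hψ.comp ?_)
    exact measurable_snd.prodMk (hlog.comp measurable_fst)
  have hdens : Measurable fun x => ENNReal.ofReal (Real.exp (-(L (c x) F.antican))) :=
    (Real.measurable_exp.comp ((F.continuous_picDual_apply _).measurable.comp
      (hL.comp hc)).neg).ennreal_ofReal
  rw [← lintegral_indicator_one hA,
    lintegral_eq_lintegral_lintegral_dite (fun ρ => ρ ∈ σ.1) (measurable_one.indicator hA),
    lintegral_congr_ae (ae_forall_ne_zero.mono inner), lintegral_lintegral_swap hswap.aemeasurable]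
  simp_rw [hL']
  rw [lintegral_const_mul _ (hdens.indicator hX)]
  congr 1
  rw [chartMeasure, Measure.map_apply (F.measurable_chart σ) hE,
    withDensity_apply _ (F.measurable_chart σ hE), ← lintegral_indicator (F.measurable_chart σ hE)]
  refine lintegral_congr_ae (ae_forall_ne_zero.mono fun x hx => ?_)
  by_cases h : F.chart σ x ∈ E
  · have hxX : x ∈ X := ⟨hx, h⟩
    rw [indicator_of_mem hxX, indicator_of_mem (show x ∈ F.chart σ ⁻¹' E from h),
      F.torsorHeight_eq_logTorsorHeight (F.chartLift_ne_zero σ hx), ← hLc]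
  · rw [indicator_of_notMem (fun h' : x ∈ X => h h'.2),
      indicator_of_notMem (show x ∉ F.chart σ ⁻¹' E from h)]

/-- No Jacobian between charts is needed: `volume_torusSet` for `σ` and `τ` computes the same
volume, and `ν(D)` cancels for any `D` with `0 < ν(D) < ∞`. -/
theorem chartMeasure_eq (σ τ : F.MaxCone) : F.chartMeasure σ = F.chartMeasure τ := by
  have hfin : SigmaFinite F.picHaar := by
    rw [F.picHaar_eq_map (F.picBasis σ)]
    exact (F.constrHomeomorph (F.picBasis σ)).toMeasurableEquiv.sigmaFinite_map
  have hsf : SigmaFinite F.nu := by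
    rw [nu]
    infer_instance
  obtain ⟨D, hD, h0, htop⟩ : ∃ D, MeasurableSet D ∧ F.nu D ≠ 0 ∧ F.nu D ≠ ⊤ := by
    by_contra! hcon
    have huniv : F.nu univ = 0 := by
      rw [← iUnion_spanningSets F.nu]
      refine measure_iUnion_null fun i => ?_
      by_contra h
      exact (measure_spanningSets_lt_top F.nu i).ne (hcon _ (measurableSet_spanningSets _ i) h)
    rw [F.nu_apply σ MeasurableSet.univ, lintegral_eq_zero_iff] at huniv
    · have := huniv.exists
      obtain ⟨l, hl⟩ := this
      simp at hl
      exact absurd hl (not_le.2 (Real.exp_pos _))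
    · simp only [indicator_univ, Pi.one_apply, mul_one]
      exact (Real.measurable_exp.comp ((F.continuous_picDual_apply _).measurable.comp
        (F.constrHomeomorph (F.picBasis σ)).continuous.measurable)).ennreal_ofReal
  ext E hE
  have h := F.volume_torusSet σ hE hD
  rw [F.torusSet_eq σ τ, F.volume_torusSet τ hE hD] at h
  refine ((ENNReal.mul_right_inj ?_ ?_).1 h).symm
  · exact mul_ne_zero (by simp) h0
  · exact ENNReal.mul_ne_top (by simp) htop

theorem muReal_eq (σ : F.MaxCone) : F.muReal = F.chartMeasure σ := by
  have : Nonempty F.MaxCone := ⟨σ⟩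
  rw [muReal]
  change ⨆ τ, F.chartMeasure τ = _
  simp_rw [fun τ => F.chartMeasure_eq τ σ]
  exact iSup_const

end SmoothProjectiveFan

namespace SmoothProjectiveFan

variable {n : ℕ} {ι : Type*} [Fintype ι] [DecidableEq ι] (F : SmoothProjectiveFan n ι)

/-! ### The region of points of the torus of bounded height -/

/-- The points over `C_σ` in the orthant given by the set `U` of positive coordinates whose height
lies in `Q`. -/
def orthantRegion (σ : F.MaxCone) (Q : Set F.PicDual) (U : Finset ι) : Set (ι → ℝ) :=
  {y | (∀ ρ, if ρ ∈ U then 0 < y ρ else y ρ < 0) ∧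
    (fun ρ => Real.log |y ρ|) ∈ F.logCone σ ∩ F.logHeight σ ⁻¹' Q}

variable {F}

theorem ne_zero_of_mem_orthantRegion {σ : F.MaxCone} {Q : Set F.PicDual} {U : Finset ι}
    {y : ι → ℝ} (hy : y ∈ F.orthantRegion σ Q U) (ρ : ι) : y ρ ≠ 0 := by
  have h := hy.1 ρ
  split_ifs at h
  · exact h.ne'
  · exact h.ne

theorem measurableSet_orthantRegion (σ : F.MaxCone) {Q : Set F.PicDual} (hQ : MeasurableSet Q)
    (U : Finset ι) : MeasurableSet (F.orthantRegion σ Q U) := by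
  have hsign : MeasurableSet {y : ι → ℝ | ∀ ρ, if ρ ∈ U then 0 < y ρ else y ρ < 0} := by
    simp only [ofPred_forall]
    refine MeasurableSet.iInter fun ρ => ?_
    split_ifs
    · exact measurableSet_lt measurable_const (measurable_pi_apply ρ)
    · exact measurableSet_lt (measurable_pi_apply ρ) measurable_const
  exact hsign.inter (measurable_log_abs
    ((F.isClosed_logCone σ).measurableSet.inter ((F.continuous_logHeight σ).measurable hQ)))

theorem convex_logCone (σ : F.MaxCone) : Convex ℝ (F.logCone σ) := by
  simp only [logCone, ofPred_forall]
  exact convex_iInter fun m => convex_iInter fun _ => convex_halfSpace_le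
    (F.logChar m).isLinear 0

theorem IsCompactPolyhedron.convex {Q : Set F.PicDual} (hQ : F.IsCompactPolyhedron Q) :
    Convex ℝ Q := by
  obtain ⟨-, k, f, c, rfl⟩ := hQ
  simp only [ofPred_forall]
  exact convex_iInter fun i => convex_halfSpace_le (f i).isLinear (c i)

theorem _root_.Convex.ordConnected_update {A : Set (ι → ℝ)} (hA : Convex ℝ A) (x : ι → ℝ) (i : ι) :
    {t | Function.update x i t ∈ A}.OrdConnected := by
  refine Convex.ordConnected fun s hs t ht a b ha hb hab => ?_
  have h := hA hs ht ha hb hab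
  rw [mem_ofPred_eq]
  convert h using 1
  ext j
  rcases eq_or_ne j i with rfl | hj
  · simp
  · simp [hj, ← add_mul, hab]

/-- The region is convex in logarithmic coordinates, and with the sign of `t` fixed by `U` the map
`t ↦ log |t|` is monotone: increasing for `t > 0`, decreasing for `t < 0`. -/
theorem ordConnected_orthantRegion (σ : F.MaxCone) {Q : Set F.PicDual} (hQ : Convex ℝ Q)
    (U : Finset ι) (y : ι → ℝ) (i : ι) :
    {t | Function.update y i t ∈ F.orthantRegion σ Q U}.OrdConnected := by
  have hconv : Convex ℝ (F.logCone σ ∩ F.logHeight σ ⁻¹' Q) :=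
    (convex_logCone σ).inter (hQ.linear_preimage (F.logHeight σ))
  have hord := hconv.ordConnected_update (fun ρ => Real.log |y ρ|) i
  have hupd : ∀ t, (fun ρ => Real.log |Function.update y i t ρ|) =
      Function.update (fun ρ => Real.log |y ρ|) i (Real.log |t|) := by
    intro t
    ext j
    rcases eq_or_ne j i with rfl | hj
    · simp
    · simp [hj]
  refine ⟨fun t₁ h₁ t₂ h₂ t ht => ⟨fun ρ => ?_, ?_⟩⟩
  · have k₁ := h₁.1 ρ
    have k₂ := h₂.1 ρ
    rcases eq_or_ne ρ i with rfl | hne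
    · simp only [Function.update_self] at k₁ k₂ ⊢
      split_ifs at k₁ k₂ ⊢
      · exact k₁.trans_le ht.1
      · exact ht.2.trans_lt k₂
    · simpa [hne] using k₁
  · have l₁ := h₁.2
    have l₂ := h₂.2
    rw [hupd] at l₁ l₂ ⊢
    refine hord.uIcc_subset l₁ l₂ ?_
    have k₁ := h₁.1 i
    have k₂ := h₂.1 i
    simp only [Function.update_self] at k₁ k₂
    split_ifs at k₁ k₂ with hi
    · refine Icc_subset_uIcc ⟨?_, ?_⟩
      · rw [abs_of_pos k₁, abs_of_pos (k₁.trans_le ht.1)]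
        exact Real.log_le_log k₁ ht.1
      · rw [abs_of_pos k₂, abs_of_pos (k₁.trans_le ht.1)]
        exact Real.log_le_log (k₁.trans_le ht.1) ht.2
    · have k := ht.2.trans_lt k₂
      refine Icc_subset_uIcc' ⟨?_, ?_⟩
      · rw [abs_of_neg k, abs_of_neg k₂]
        exact Real.log_le_log (neg_pos.2 k₂) (neg_le_neg ht.2)
      · rw [abs_of_neg k, abs_of_neg k₁]
        exact Real.log_le_log (neg_pos.2 k) (neg_le_neg ht.1)

theorem exists_bound_orthantRegion {D : Set F.PicDual} (hD : IsCompact D) :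
    ∃ c : ℝ, 0 < c ∧ ∀ σ, ∀ Q ⊆ D, ∀ U, ∀ y ∈ F.orthantRegion σ Q U, ∀ ρ, |y ρ| ≤ c := by
  have h : ∀ ρ, ∃ C : ℝ, ∀ v ∈ D, ‖v (F.classD ρ)‖ ≤ C := fun ρ =>
    hD.exists_bound_of_continuousOn (F.continuous_picDual_apply _).continuousOn
  choose C hC using h
  refine ⟨Real.exp (∑ ρ, |C ρ|), Real.exp_pos _, fun σ Q hQ U y hy ρ => ?_⟩
  rw [← Real.log_le_iff_le_exp (abs_pos.2 (ne_zero_of_mem_orthantRegion hy ρ))]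
  calc Real.log |y ρ| ≤ _ := F.le_logHeight_classD hy.2.1 ρ
    _ ≤ C ρ := (le_abs_self _).trans (hC ρ _ (hQ hy.2.2))
    _ ≤ |C ρ| := le_abs_self _
    _ ≤ ∑ ρ, |C ρ| := Finset.single_le_sum (f := fun ρ => |C ρ|) (fun _ _ => abs_nonneg _)
      (Finset.mem_univ ρ)

theorem mem_torusSet_univ_iff (τ : F.MaxCone) (D : Set F.PicDual) (y : ι → ℝ) :
    y ∈ F.torusSet τ univ D ↔ (∀ ρ, y ρ ≠ 0) ∧ F.torsorHeight y ∈ D := by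
  refine and_congr_right fun hy => ?_
  rw [F.torsorHeight_eq_logTorsorHeight hy]
  exact and_iff_right (mem_univ _)

theorem iUnion_orthantRegion {κ : Type*} (τ : F.MaxCone) (P : κ → Set F.PicDual) :
    ⋃ a : F.MaxCone × κ × Finset ι, F.orthantRegion a.1 (P a.2.1) a.2.2 =
      F.torusSet τ univ (⋃ j, P j) := by
  ext y
  rw [mem_torusSet_univ_iff]
  constructor
  · intro h
    obtain ⟨⟨σ, j, U⟩, ha⟩ := mem_iUnion.1 h
    have hy := ne_zero_of_mem_orthantRegion ha
    refine ⟨hy, mem_iUnion.2 ⟨j, ?_⟩⟩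
    rw [F.torsorHeight_eq hy ha.2.1]
    exact ha.2.2
  · rintro ⟨hy, h⟩
    obtain ⟨j, hj⟩ := mem_iUnion.1 h
    obtain ⟨σ, hσ⟩ := F.exists_mem_logCone (fun ρ => Real.log |y ρ|)
    refine mem_iUnion.2 ⟨⟨σ, j, Finset.univ.filter fun ρ => 0 < y ρ⟩, fun ρ => ?_, hσ, ?_⟩
    · by_cases h : 0 < y ρ
      · simp [h]
      · simpa [h] using lt_of_le_of_ne (not_lt.1 h) (hy ρ)
    · rw [mem_preimage, ← F.torsorHeight_eq hy hσ]
      exact hj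

/-! ### The counting function -/

/-- Equivariance of the height with `v = log B • u` moves the dependence on `B` from the region to
the grid. -/
theorem latticePoints_eq_image (τ : F.MaxCone) (D : Set F.PicDual) (u : F.PicDual) {d : ι → ℕ}
    (hd : ∀ ρ, 0 < d ρ) {B : ℝ} (hB : 0 < B) :
    F.latticePoints D u d B = (fun (z : ι → ℤ) ρ => (d ρ : ℝ) * z ρ) ''
      {z | (fun ρ => d ρ / B ^ u (F.classD ρ) * z ρ) ∈ F.torusSet τ univ D} := by
  have hpow : ∀ ρ, 0 < B ^ u (F.classD ρ) := fun ρ => Real.rpow_pos_of_pos hB _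
  have hd' : ∀ ρ, (0 : ℝ) < d ρ := fun ρ => Nat.cast_pos.2 (hd ρ)
  have key : ∀ z : ι → ℤ, ((∀ ρ, (d ρ : ℝ) * z ρ ≠ 0) ∧
      F.torsorHeight (fun ρ => (d ρ : ℝ) * z ρ) ∈ F.translate D u B) ↔
      (fun ρ => d ρ / B ^ u (F.classD ρ) * z ρ) ∈ F.torusSet τ univ D := by
    intro z
    have hne : (∀ ρ, (d ρ : ℝ) * z ρ ≠ 0) ↔ ∀ ρ, d ρ / B ^ u (F.classD ρ) * z ρ ≠ 0 :=
      forall_congr' fun ρ => by simp [(hd ρ).ne', (hpow ρ).ne']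
    rw [mem_torusSet_univ_iff, hne]
    refine and_congr_right fun hw => ?_
    have hy := hne.2 hw
    rw [F.torsorHeight_eq_add (w := fun ρ => (d ρ : ℝ) * z ρ) hw hy (Real.log B • u), translate]
    · constructor
      · rintro ⟨v, hv, h⟩
        rwa [← add_right_cancel h]
      · exact fun h => ⟨_, h, rfl⟩
    · intro ρ
      have hz : d ρ * (z ρ : ℝ) = d ρ / B ^ u (F.classD ρ) * z ρ * B ^ u (F.classD ρ) := by
        field_simp [(hpow ρ).ne']
      rw [hz, abs_mul, Real.log_mul (abs_ne_zero.2 (hw ρ)) (abs_ne_zero.2 (hpow ρ).ne'),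
        abs_of_pos (hpow ρ), Real.log_rpow hB, LinearMap.smul_apply, smul_eq_mul, mul_comm (u _)]
  ext y
  constructor
  · rintro ⟨⟨z, hz⟩, hy, hh⟩
    obtain rfl : y = fun ρ => (d ρ : ℝ) * z ρ := funext hz
    exact ⟨z, (key z).1 ⟨hy, hh⟩, rfl⟩
  · rintro ⟨z, hz, rfl⟩
    exact ⟨⟨z, fun ρ => rfl⟩, (key z).2 hz⟩

theorem exists_abs_card_torusSet_sub_le (τ : F.MaxCone) {k : ℕ} {P : Fin k → Set F.PicDual}
    (hP : ∀ j, F.IsCompactPolyhedron (P j)) :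
    ∃ C : ℝ, 0 ≤ C ∧ ∀ ε : ι → ℝ, (∀ i, 0 < ε i) →
      {z : ι → ℤ | (fun i => ε i * z i) ∈ F.torusSet τ univ (⋃ j, P j)}.Finite ∧
      |({z : ι → ℤ | (fun i => ε i * z i) ∈ F.torusSet τ univ (⋃ j, P j)}.ncard : ℝ) * ∏ i, ε i -
        2 ^ F.picRank * F.muReal.real univ * F.nu.real (⋃ j, P j)| ≤ C * ∑ i, ε i := by
  have hPm : ∀ j, MeasurableSet (P j) := fun j => (hP j).1.isClosed.measurableSet
  obtain ⟨c, hc, hbound⟩ := exists_bound_orthantRegion (isCompact_iUnion fun j => (hP j).1)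
  have := Fintype.ofFinite F.MaxCone
  have htame : TameRegion (F.MaxCone × Fin k × Finset ι)
      (fun a => F.orthantRegion a.1 (P a.2.1) a.2.2) c :=
    { measurable := fun a => measurableSet_orthantRegion a.1 (hPm a.2.1) a.2.2
      ordConnected := fun a => ordConnected_orthantRegion a.1 (hP a.2.1).convex a.2.2
      bound := fun a => hbound a.1 _ (subset_iUnion P a.2.1) a.2.2 }
  obtain ⟨C, hC, h⟩ := htame.exists_abs_card_sub_le hc fun a y hy => ne_zero_of_mem_orthantRegion hy
  rw [iUnion_orthantRegion τ P] at h
  refine ⟨C, hC, ?_⟩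
  rwa [measureReal_def, F.volume_torusSet τ MeasurableSet.univ (MeasurableSet.iUnion hPm),
    ← F.muReal_eq τ, ENNReal.toReal_mul, ENNReal.toReal_mul, ENNReal.toReal_pow,
    ENNReal.toReal_ofNat, mul_right_comm] at h

theorem prod_rpow_classD (u : F.PicDual) {B : ℝ} (hB : 0 < B) :
    ∏ ρ, B ^ u (F.classD ρ) = B ^ u F.antican := by
  rw [antican, map_sum, Real.rpow_sum_of_pos hB]

end SmoothProjectiveFan

/-! ### The asymptotic formula. -/

theorem mainTheorem3 {n : ℕ} {ι : Type*} [Fintype ι] [DecidableEq ι] [Nonempty ι]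
    (F : SmoothProjectiveFan n ι) (k : ℕ) (P : Fin k → Set F.PicDual)
    (hP : ∀ j, F.IsCompactPolyhedron (P j)) :
    ∃ C : ℝ, 0 < C ∧ ∀ u ∈ interior F.effDual, ∀ d : ι → ℕ, (∀ ρ, 0 < d ρ) → ∀ B : ℝ, 1 ≤ B →
      (F.latticePoints (⋃ j, P j) u d B).Finite ∧
      |((F.latticePoints (⋃ j, P j) u d B).ncard : ℝ) -
          2 ^ F.picRank * F.muReal.real Set.univ * F.nu.real (⋃ j, P j) * B ^ (u F.antican) /
            ∏ ρ, (d ρ : ℝ)| ≤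
        C * B ^ (u F.antican -
          Finset.univ.inf' Finset.univ_nonempty (fun ρ => u (F.classD ρ))) := by

  classical
  obtain ⟨τ⟩ := F.nonempty_maxCone
  obtain ⟨C, hC, hcount⟩ := SmoothProjectiveFan.exists_abs_card_torusSet_sub_le τ hP
  -- One error term for each ray; the `+ 1` makes the constant positive even if `C = 0`.
  refine ⟨C * Fintype.card ι + 1, by positivity, fun u _ d hd B hB => ?_⟩
  have hB0 : 0 < B := one_pos.trans_le hB
  have hpow : ∀ ρ, 0 < B ^ u (F.classD ρ) := fun ρ => Real.rpow_pos_of_pos hB0 _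
  have hd' : ∀ ρ, (0 : ℝ) < d ρ := fun ρ => Nat.cast_pos.2 (hd ρ)
  let ε : ι → ℝ := fun ρ => d ρ / B ^ u (F.classD ρ)
  have hε : ∀ ρ, 0 < ε ρ := fun ρ => div_pos (hd' ρ) (hpow ρ)
  obtain ⟨hfin, hle⟩ := hcount ε hε
  have hinj : Function.Injective fun (z : ι → ℤ) ρ => (d ρ : ℝ) * z ρ := by
    intro z z' h
    ext ρ
    exact_mod_cast mul_left_cancel₀ (hd' ρ).ne' (congrFun h ρ)
  rw [SmoothProjectiveFan.latticePoints_eq_image τ _ u hd hB0]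
  refine ⟨hfin.image _, ?_⟩
  rw [ncard_image_of_injective _ hinj]
  set N : ℝ := ({z : ι → ℤ | (fun i => ε i * z i) ∈ F.torusSet τ univ (⋃ j, P j)}.ncard : ℝ)
  set V : ℝ := 2 ^ F.picRank * F.muReal.real univ * F.nu.real (⋃ j, P j)
  set m : ℝ := Finset.univ.inf' Finset.univ_nonempty (fun ρ => u (F.classD ρ))
  have hprodd : (0 : ℝ) < ∏ ρ, (d ρ : ℝ) := Finset.prod_pos fun ρ _ => hd' ρ
  have hΛ : 0 < B ^ u F.antican := Real.rpow_pos_of_pos hB0 _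
  have hprod : ∏ ρ, ε ρ = (∏ ρ, (d ρ : ℝ)) / B ^ u F.antican := by
    rw [Finset.prod_div_distrib, SmoothProjectiveFan.prod_rpow_classD u hB0]
  have hprodpos : 0 < ∏ ρ, ε ρ := Finset.prod_pos fun ρ _ => hε ρ
  have hmain : N - V * B ^ u F.antican / ∏ ρ, (d ρ : ℝ) = (N * ∏ ρ, ε ρ - V) / ∏ ρ, ε ρ := by
    rw [hprod]
    field_simp
  -- Uniformity in `d` comes from `d ρ ≤ ∏ d`, which holds since all `d ρ` are positive integers.
  have hterm : ∀ ρ, ε ρ / ∏ ρ, ε ρ ≤ B ^ (u F.antican - m) := by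
    intro ρ
    have hdle : (d ρ : ℝ) ≤ ∏ ρ, (d ρ : ℝ) := by
      exact_mod_cast Nat.le_of_dvd (Finset.prod_pos fun ρ _ => hd ρ)
        (Finset.dvd_prod_of_mem d (Finset.mem_univ ρ))
    have hm : m ≤ u (F.classD ρ) := Finset.inf'_le _ (Finset.mem_univ ρ)
    calc ε ρ / ∏ ρ, ε ρ
        = d ρ / (∏ ρ, (d ρ : ℝ)) * (B ^ u F.antican / B ^ u (F.classD ρ)) := by
          rw [hprod]
          simp only [ε]
          field_simp
      _ ≤ 1 * (B ^ u F.antican / B ^ u (F.classD ρ)) := by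
          gcongr
          exact div_le_one_of_le₀ hdle hprodd.le
      _ = B ^ (u F.antican - u (F.classD ρ)) := by rw [one_mul, Real.rpow_sub hB0]
      _ ≤ B ^ (u F.antican - m) := Real.rpow_le_rpow_of_exponent_le hB (by linarith)
  rw [hmain, abs_div, abs_of_pos hprodpos]
  calc |N * ∏ ρ, ε ρ - V| / ∏ ρ, ε ρ ≤ C * (∑ ρ, ε ρ) / ∏ ρ, ε ρ := by gcongr
    _ = C * ∑ ρ, ε ρ / ∏ ρ, ε ρ := by rw [mul_div_assoc, Finset.sum_div]
    _ ≤ C * ∑ _ρ : ι, B ^ (u F.antican - m) := by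
        gcongr with ρ
        exact hterm ρ
    _ = C * Fintype.card ι * B ^ (u F.antican - m) := by
        rw [Finset.sum_const, Finset.card_univ, nsmul_eq_mul, mul_assoc]
    _ ≤ _ := by
        rw [add_mul, one_mul]
        exact le_add_of_nonneg_right (Real.rpow_nonneg hB0.le _)
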